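/- Let $\mathbb{T}=\mathbb{R}/2\pi\mathbb{Z}$, write $(x,y)=(x_1,x_2,y)$ for the points of $\mathbb{R}^2\times\mathbb{T}$, and put $\Delta=\partial_{x_1}^2+\partial_{x_2}^2+\partial_y^2$, $\dot V=\partial_tV$ and $\partial_{x,y}^\rho=\partial_{x_1}^{\rho_1}\partial_{x_2}^{\rho_2}\partial_y^{\rho_3}$ for multi-indices $\rho\in\mathbb{N}_0^3$. Let $V_0,V_1\in C_0^\infty(\mathbb{R}^2\times\mathbb{T})$ be complex-valued (for instance real-valued). Then there is a constant $C>0$, depending only on $V_0$ and $V_1$, such that every smooth solution $V$ on $[0,\infty)\times\mathbb{R}^2\times\mathbb{T}$ of the linear Klein–Gordon problem $$(\partial_t^2-\Delta+1)V=0,\qquad (V(0),\dot V(0))=(V_0,V_1),$$ satisfies, for all $t\ge 0$, $$\sum_{|\rho|\le2}\|\partial_{x,y}^\rho V(t)\|_{L^\infty(\mathbb{R}^2\times\mathbb{T})}+\sum_{|\rho|\le1}\|\partial_{x,y}^\rho\dot V(t)\|_{L^\infty(\mathbb{R}^2\times\mathbb{T})}\le C(1+t)^{-1}.$$ -/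

import Mathlib

open MeasureTheory Set
open scoped ENNReal ContDiff

noncomputable section

namespace KG

instance fact_two_pi_pos : Fact (0 < 2 * Real.pi) := ⟨Real.two_pi_pos⟩

/-- The Euclidean plane `ℝ²`. -/
abbrev Plane : Type := EuclideanSpace ℝ (Fin 2)

/-- The circle `𝕋 = ℝ / 2πℤ`. -/
abbrev Torus : Type := AddCircle (2 * Real.pi)

/-- The product space `ℝ² × 𝕋`, with its product topology and product measure. -/
abbrev Space : Type := Plane × Torus

/-- `shift j s` is the displacement by `s` in the `j`-th coordinate direction of `ℝ² × 𝕋`: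
`j = 0, 1` are the directions `x₁, x₂`, and `j = 2` is the periodic direction `y`. -/
def shift (j : Fin 3) (s : ℝ) : Space :=
  ![(EuclideanSpace.single 0 s, 0), (EuclideanSpace.single 1 s, 0), (0, (s : Torus))] j

/-- The partial derivative `∂_j f` of a function on `ℝ² × 𝕋`, where
`∂_0 = ∂_{x₁}`, `∂_1 = ∂_{x₂}`, `∂_2 = ∂_y`. -/
def pderiv (j : Fin 3) (f : Space → ℂ) : Space → ℂ :=
  fun p => deriv (fun s : ℝ => f (p + shift j s)) 0

/-- The derivative `∂_{x,y}^ρ f = ∂_{x₁}^{ρ 0} ∂_{x₂}^{ρ 1} ∂_y^{ρ 2} f` for a multi-index `ρ`. -/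
def multiDeriv (ρ : Fin 3 → ℕ) (f : Space → ℂ) : Space → ℂ :=
  (pderiv 0)^[ρ 0] ((pderiv 1)^[ρ 1] ((pderiv 2)^[ρ 2] f))

/-- The finite set of multi-indices `ρ ∈ ℕ³` with `|ρ| = ρ 0 + ρ 1 + ρ 2 ≤ m`. -/
def multiIndices (m : ℕ) : Finset (Fin 3 → ℕ) :=
  (Fintype.piFinset fun _ => Finset.range (m + 1)).filter fun ρ => ∑ i, ρ i ≤ m

theorem mem_multiIndices {m : ℕ} {ρ : Fin 3 → ℕ} : ρ ∈ multiIndices m ↔ ∑ i, ρ i ≤ m := by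
  simp only [multiIndices, Finset.mem_filter, Fintype.mem_piFinset, Finset.mem_range,
    and_iff_right_iff_imp]
  intro h i
  have := Finset.single_le_sum (fun j _ => Nat.zero_le (ρ j)) (Finset.mem_univ i)
  omega

/-- The Laplacian `Δ_{x,y} = ∂_{x₁}² + ∂_{x₂}² + ∂_y²` on `ℝ² × 𝕋`. -/
def laplacian (f : Space → ℂ) : Space → ℂ :=
  fun p => ∑ j : Fin 3, pderiv j (pderiv j f) p

/-- `f ∈ C_0^∞(ℝ² × 𝕋)`: `f` is smooth and has compact support. As `ℝ² × ℝ → ℝ² × 𝕋` is a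
smooth covering, smoothness on `ℝ² × 𝕋` is smoothness of the lift to `ℝ² × ℝ`. -/
def IsTestFunction (f : Space → ℂ) : Prop :=
  ContDiff ℝ ∞ (fun q : Plane × ℝ => f (q.1, (q.2 : Torus))) ∧ HasCompactSupport f

/-- `V` is smooth on `[0, ∞) × ℝ² × 𝕋`, up to the boundary `t = 0`. The values of `V` at negative
times are irrelevant. -/
def IsSmoothOnHalfLine (V : ℝ → Space → ℂ) : Prop :=
  ContDiffOn ℝ ∞ (fun q : ℝ × (Plane × ℝ) => V q.1 (q.2.1, (q.2.2 : Torus))) (Ici 0 ×ˢ univ)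

/-- The time derivative `V̇(t)` of a function on `[0, ∞) × ℝ² × 𝕋`; it is one-sided at `t = 0`. -/
def dt (V : ℝ → Space → ℂ) : ℝ → Space → ℂ :=
  fun t p => derivWithin (fun τ => V τ p) (Ici 0) t

/-- `V` is a smooth solution on `[0, ∞) × ℝ² × 𝕋` of `(∂_t² - Δ_{x,y} + 1) V = 0` with
`(V(0), V̇(0)) = (V₀, V₁)`. -/
structure IsSmoothSolution (V : ℝ → Space → ℂ) (V₀ V₁ : Space → ℂ) : Prop where
  smooth : IsSmoothOnHalfLine V
  equation : ∀ t : ℝ, 0 ≤ t → ∀ p : Space, dt (dt V) t p - laplacian (V t) p + V t p = 0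
  initial_value : ∀ p : Space, V 0 p = V₀ p
  initial_velocity : ∀ p : Space, dt V 0 p = V₁ p

/-- The norm of `L^∞(ℝ² × 𝕋)`, with values in `[0, ∞]`. -/
def supNorm (f : Space → ℂ) : ℝ≥0∞ := eLpNorm f ∞ volume

end KG

end

/-! The proof is Klainerman's vector field method on hyperboloids. If the data live in |x| ≤ R, the
solution lives in |x| ≤ R + t. Put c = R + 1. The boosts L_i = x_i ∂_t + (t + c) ∂_i for i = 1, 2
and the field ∂_y commute with the Klein–Gordon operator, so L_1 u, L_2 u, L_1 L_2 u and the same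
expressions in ∂_y u are again solutions with the same support (`IsKGSol.boost`, `IsKGSol.D`).

For σ > c² the hyperboloid (t + c)² - |x|² = σ lies in t > 0, and energy conservation between it and
t = 0 bounds the integral of u² over it, with respect to dx dy, by the initial energy, uniformly in
σ (`hyperboloid_energy_le`). It is the mass term that gives control of u itself.

Along the hyperboloid the x_i-derivative of u is L_i u / T, where T = √(σ + |x|²) = t + c.
Integrating ∂_1 ∂_2 (u²) from a point a outwards, away from the axes, meets only points with T at
least its value at a. Hence u² at a is at most (t + c)⁻² times integrals already bounded; the
variable y costs one more derivative ∂_y, by a Sobolev inequality on the circle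
(`sq_le_integral_boostSq`). Each of the two planar directions contributes a factor T⁻¹ to u², which
gives the rate 1/t for u.

Every late point of the support lies on such a hyperboloid, and early times are covered by
compactness (`IsKGSol.exists_decay`). Derivatives of V solve the same equation, so this pointwise
bound serves for each term of the sum. Finally, a local energy estimate in backward cones
(`eq_zero_of_initial_eq_zero`) yields both the support property and uniqueness; by uniqueness the
constant found for one solution depends on the data alone. -/

noncomputable section

namespace KG

/-! ### One-sided calculus on the half space t ≥ 0 -/

section

/-- Coordinates `(t, x₁, x₂, y)` on the universal cover of space-time. -/
abbrev Coord : Type := Fin 4 → ℝ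

/-- The half space `t ≥ 0`. -/
def half : Set Coord := {q | 0 ≤ q 0}

/-- The coordinate vector field `∂_i`. -/
abbrev unitVec (i : Fin 4) : Coord := Pi.single i 1

variable {F G : Type*} [NormedAddCommGroup F] [NormedSpace ℝ F]
  [NormedAddCommGroup G] [NormedSpace ℝ G]

/-- The `i`-th partial derivative on the half space `t ≥ 0`, one-sided in `t` on the boundary. -/
def D (i : Fin 4) (u : Coord → F) (q : Coord) : F := fderivWithin ℝ u half q (unitVec i)

theorem convex_half : Convex ℝ half := by
  intro p hp q hq a b ha hb _
  have hp' : 0 ≤ p 0 := hp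
  have hq' : 0 ≤ q 0 := hq
  change 0 ≤ (a • p + b • q) 0
  simp only [Pi.add_apply, Pi.smul_apply, smul_eq_mul]
  positivity

theorem isOpen_pos : IsOpen {q : Coord | 0 < q 0} :=
  isOpen_lt continuous_const (continuous_apply 0)

theorem half_mem_nhds {q : Coord} (hq : 0 < q 0) : half ∈ nhds q :=
  Filter.mem_of_superset (isOpen_pos.mem_nhds hq) fun p (h : 0 < p 0) => h.le

theorem uniqueDiffOn_half : UniqueDiffOn ℝ half :=
  uniqueDiffOn_convex convex_half
    ⟨fun _ => 1, mem_interior_iff_mem_nhds.2 (half_mem_nhds (by norm_num))⟩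

theorem half_subset_closure_interior : half ⊆ closure (interior half) := by
  rw [convex_half.closure_interior_eq_closure_of_nonempty_interior
    ⟨fun _ => 1, mem_interior_iff_mem_nhds.2 (half_mem_nhds (by norm_num))⟩]
  exact subset_closure

section calculus

open scoped Pointwise

variable {u v : Coord → F} {q : Coord} {i j : Fin 4}

theorem contDiffOn_D (hu : ContDiffOn ℝ ∞ u half) (i : Fin 4) : ContDiffOn ℝ ∞ (D i u) half :=
  (hu.fderivWithin uniqueDiffOn_half (m := ∞) (by simp)).clm_apply contDiffOn_const

theorem _root_.ContDiffOn.diffWithinAt_half (hu : ContDiffOn ℝ ∞ u half) (hq : q ∈ half) :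
    DifferentiableWithinAt ℝ u half q :=
  hu.differentiableOn (by simp) q hq

theorem D_congr (h : EqOn u v half) (hq : q ∈ half) : D i u q = D i v q := by
  rw [D, D, fderivWithin_congr h (h hq)]

theorem D_add (hu : DifferentiableWithinAt ℝ u half q) (hv : DifferentiableWithinAt ℝ v half q)
    (hq : q ∈ half) : D i (fun p => u p + v p) q = D i u q + D i v q := by
  simp [D, fderivWithin_fun_add (uniqueDiffOn_half q hq) hu hv]

theorem D_sub (hu : DifferentiableWithinAt ℝ u half q) (hv : DifferentiableWithinAt ℝ v half q)
    (hq : q ∈ half) : D i (fun p => u p - v p) q = D i u q - D i v q := by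
  simp [D, fderivWithin_fun_sub (uniqueDiffOn_half q hq) hu hv]

theorem D_const_smul (c : ℝ) (hu : DifferentiableWithinAt ℝ u half q)
    (hq : q ∈ half) : D i (fun p => c • u p) q = c • D i u q := by
  simp [D, fderivWithin_fun_const_smul (uniqueDiffOn_half q hq) hu]

theorem D_smul {a : Coord → ℝ} (ha : DifferentiableWithinAt ℝ a half q)
    (hu : DifferentiableWithinAt ℝ u half q) (hq : q ∈ half) :
    D i (fun p => a p • u p) q = D i a q • u q + a q • D i u q := by
  simp [D, fderivWithin_fun_smul (uniqueDiffOn_half q hq) ha hu, add_comm]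

theorem D_mul {a b : Coord → ℝ} (ha : DifferentiableWithinAt ℝ a half q)
    (hb : DifferentiableWithinAt ℝ b half q) (hq : q ∈ half) :
    D i (fun p => a p * b p) q = D i a q * b q + a q * D i b q := by
  simpa using D_smul (i := i) ha hb hq

theorem D_clm (ℓ : F →L[ℝ] G) (hu : DifferentiableWithinAt ℝ u half q) (hq : q ∈ half) :
    D i (fun p => ℓ (u p)) q = ℓ (D i u q) := by
  have := ℓ.hasFDerivAt.comp_hasFDerivWithinAt q hu.hasFDerivWithinAt
  simp only [D]
  rw [show (fun p => ℓ (u p)) = ℓ ∘ u from rfl, this.fderivWithin (uniqueDiffOn_half q hq)]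
  rfl

theorem D_coord (c : ℝ) (hq : q ∈ half) :
    D i (fun p : Coord => p j + c) q = if i = j then 1 else 0 := by
  have h : HasFDerivWithinAt (fun p : Coord => p j + c)
      (ContinuousLinearMap.proj (R := ℝ) (φ := fun _ : Fin 4 => ℝ) j) half q :=
    ((ContinuousLinearMap.proj (R := ℝ) (φ := fun _ : Fin 4 => ℝ) j).hasFDerivWithinAt).add_const c
  simp [D, h.fderivWithin (uniqueDiffOn_half q hq), Pi.single_apply, eq_comm]

/-- Both sides are values of the second derivative within `half`. Its symmetry persists on the
boundary t = 0 because `half` lies in the closure of its interior. -/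
theorem D_comm (hu : ContDiffOn ℝ ∞ u half) (hq : q ∈ half) : D i (D j u) q = D j (D i u) q := by
  have key : ∀ i j, D i (D j u) q = fderivWithin ℝ (fderivWithin ℝ u half) half q
      (unitVec i) (unitVec j) := by
    intro i j
    have h := ((hu.fderivWithin uniqueDiffOn_half (m := ∞) (by simp)).differentiableOn
      (by simp) q hq).hasFDerivWithinAt
    have h2 := h.clm_apply (hasFDerivWithinAt_const (unitVec j) q half)
    have : D i (D j u) q = fderivWithin ℝ
      (fun p => fderivWithin ℝ u half p (unitVec j)) half q (unitVec i) := rfl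
    rw [this, h2.fderivWithin (uniqueDiffOn_half q hq)]
    simp
  rw [key, key]
  exact (hu q hq).isSymmSndFDerivWithinAt (by simpa using WithTop.coe_le_coe.2 (le_top (a := (2 : ℕ∞))))
    uniqueDiffOn_half (half_subset_closure_interior hq) hq _ _

theorem D_eq_zero_of_eventually (h : ∀ᶠ p in nhdsWithin q half, u p = 0) (hq : q ∈ half) :
    D i u q = 0 := by
  have : fderivWithin ℝ u half q = fderivWithin ℝ (fun _ => (0 : F)) half q :=
    Filter.EventuallyEq.fderivWithin_eq h (h.self_of_nhdsWithin hq)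
  simp [D, this]

theorem contDiffOn_coord (c : ℝ) (j : Fin 4) : ContDiffOn ℝ ∞ (fun p : Coord => p j + c) half :=
  ((contDiff_apply ℝ ℝ j).add contDiff_const).contDiffOn

theorem contDiffOn_coord_smul (c : ℝ) (j : Fin 4) (hu : ContDiffOn ℝ ∞ u half) :
    ContDiffOn ℝ ∞ (fun p => (p j + c) • u p) half :=
  (contDiffOn_coord c j).smul hu

/-- This is the commutator [∂_i², x_j + c] = 2 δ_ij ∂_i, the only one needed to commute boosts with
the equation. -/
theorem D_D_coord_smul (c : ℝ) (hu : ContDiffOn ℝ ∞ u half) (hq : q ∈ half) :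
    D i (D i (fun p => (p j + c) • u p)) q
      = (if i = j then (2 : ℝ) else 0) • D i u q + (q j + c) • D i (D i u) q := by
  have h1 : EqOn (D i (fun p => (p j + c) • u p))
      (fun p => (if i = j then (1 : ℝ) else 0) • u p + (p j + c) • D i u p) half := by
    intro p hp
    rw [D_smul ((contDiffOn_coord c j).diffWithinAt_half hp) (hu.diffWithinAt_half hp) hp,
      D_coord c hp]
  have hDu := contDiffOn_D hu i
  rw [D_congr h1 hq, D_add ((hu.const_smul _).diffWithinAt_half hq)
    ((contDiffOn_coord_smul c j hDu).diffWithinAt_half hq) hq,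
    D_const_smul _ (hu.diffWithinAt_half hq) hq,
    D_smul ((contDiffOn_coord c j).diffWithinAt_half hq) (hDu.diffWithinAt_half hq) hq,
    D_coord c hq, ← add_assoc, ← add_smul]
  split_ifs <;> norm_num

theorem D_D_add (hu : ContDiffOn ℝ ∞ u half) (hv : ContDiffOn ℝ ∞ v half) (hq : q ∈ half) :
    D i (D j (fun p => u p + v p)) q = D i (D j u) q + D i (D j v) q := by
  have h1 : EqOn (D j (fun p => u p + v p)) (fun p => D j u p + D j v p) half := fun p hp =>
    D_add (hu.diffWithinAt_half hp) (hv.diffWithinAt_half hp) hp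
  rw [D_congr h1 hq, D_add ((contDiffOn_D hu j).diffWithinAt_half hq)
    ((contDiffOn_D hv j).diffWithinAt_half hq) hq]

theorem D_D_sub (hu : ContDiffOn ℝ ∞ u half) (hv : ContDiffOn ℝ ∞ v half) (hq : q ∈ half) :
    D i (D j (fun p => u p - v p)) q = D i (D j u) q - D i (D j v) q := by
  have h1 : EqOn (D j (fun p => u p - v p)) (fun p => D j u p - D j v p) half := fun p hp =>
    D_sub (hu.diffWithinAt_half hp) (hv.diffWithinAt_half hp) hp
  rw [D_congr h1 hq, D_sub ((contDiffOn_D hu j).diffWithinAt_half hq)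
    ((contDiffOn_D hv j).diffWithinAt_half hq) hq]

theorem D_D_clm (ℓ : F →L[ℝ] G) (hu : ContDiffOn ℝ ∞ u half) (hq : q ∈ half) :
    D i (D j (fun p => ℓ (u p))) q = ℓ (D i (D j u) q) := by
  have h1 : EqOn (D j (fun p => ℓ (u p))) (fun p => ℓ (D j u p)) half := fun p hp =>
    D_clm ℓ (hu.diffWithinAt_half hp) hp
  rw [D_congr h1 hq, D_clm ℓ ((contDiffOn_D hu j).diffWithinAt_half hq) hq]

theorem D_D_D_comm (hu : ContDiffOn ℝ ∞ u half) (hq : q ∈ half) :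
    D i (D i (D j u)) q = D j (D i (D i u)) q := by
  have h1 : EqOn (D i (D j u)) (D j (D i u)) half := fun p hp => D_comm hu hp
  rw [D_congr h1 hq, D_comm (contDiffOn_D hu i) hq]

theorem add_vec_mem_half (hq : q ∈ half) (c : ℝ) : q + (Pi.single 3 c : Coord) ∈ half := by
  change 0 ≤ (q + (Pi.single 3 c : Coord)) 0
  simpa using show 0 ≤ q 0 from hq

theorem D_periodic {c : ℝ} (h : ∀ p ∈ half, u (p + Pi.single 3 c) = u p) (hq : q ∈ half) :
    D i u (q + Pi.single 3 c) = D i u q := by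
  have h1 := fderivWithin_comp_add_right (𝕜 := ℝ) (f := u) (s := half) (x := q)
    (Pi.single 3 c : Coord)
  have h2 : (Pi.single 3 c : Coord) +ᵥ half = half := by
    ext p
    rw [mem_vadd_set_iff_neg_vadd_mem]
    change 0 ≤ (-(Pi.single 3 c : Coord) + p) 0 ↔ 0 ≤ p 0
    simp
  rw [h2] at h1
  rw [D, ← h1, fderivWithin_congr h (h q hq), D]

end calculus

/-! ### Klein–Gordon solutions and their symmetries -/

/-- The Klein–Gordon operator `∂_t² - Δ + 1`. -/
def kgOp (u : Coord → F) (q : Coord) : F :=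
  D 0 (D 0 u) q - (D 1 (D 1 u) q + D 2 (D 2 u) q + D 3 (D 3 u) q) + u q

/-- Smooth solutions of the Klein–Gordon equation for `t ≥ 0` which are `2π`-periodic in `y` and
vanish for `|x| > R + t`. -/
structure IsKGSol (R : ℝ) (u : Coord → F) : Prop where
  smooth : ContDiffOn ℝ ∞ u half
  equation : ∀ q ∈ half, kgOp u q = 0
  support : ∀ q ∈ half, (R + q 0) ^ 2 < q 1 ^ 2 + q 2 ^ 2 → u q = 0
  periodic : ∀ q ∈ half, u (q + Pi.single 3 (2 * Real.pi)) = u q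

namespace IsKGSol

variable {R : ℝ} {u v : Coord → F}

theorem congr (hu : IsKGSol R u) (h : EqOn v u half) : IsKGSol R v where
  smooth := hu.smooth.congr h
  equation q hq := by
    rw [← hu.equation q hq, kgOp, kgOp, h hq,
      D_congr (fun p hp => D_congr h hp) hq, D_congr (fun p hp => D_congr h hp) hq,
      D_congr (fun p hp => D_congr h hp) hq, D_congr (fun p hp => D_congr h hp) hq]
  support q hq hs := by rw [h hq, hu.support q hq hs]
  periodic q hq := by rw [h hq, h (add_vec_mem_half hq _), hu.periodic q hq]

theorem clm (hu : IsKGSol R u) (ℓ : F →L[ℝ] G) : IsKGSol R (fun p => ℓ (u p)) where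
  smooth := ℓ.contDiff.comp_contDiffOn hu.smooth
  equation q hq := by
    rw [← map_zero ℓ, ← hu.equation q hq, kgOp, kgOp]
    simp only [D_D_clm ℓ hu.smooth hq, map_add, map_sub]
  support q hq hs := by rw [hu.support q hq hs, map_zero]
  periodic q hq := by rw [hu.periodic q hq]

theorem D (hu : IsKGSol R u) (i : Fin 4) : IsKGSol R (D i u) where
  smooth := contDiffOn_D hu.smooth i
  equation q hq := by
    have hs : ∀ j, DifferentiableWithinAt ℝ (KG.D j (KG.D j u)) half q := fun j =>
      (contDiffOn_D (contDiffOn_D hu.smooth j) j).diffWithinAt_half hq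
    have h0 : KG.D i (kgOp u) q = KG.D i (fun _ => (0 : F)) q :=
      D_congr (fun p hp => hu.equation p hp) hq
    have h1 : KG.D i (fun _ => (0 : F)) q = 0 := by simp [KG.D]
    have h2 : KG.D i (kgOp u) q = KG.D i (KG.D 0 (KG.D 0 u)) q - (KG.D i (KG.D 1 (KG.D 1 u)) q
        + KG.D i (KG.D 2 (KG.D 2 u)) q + KG.D i (KG.D 3 (KG.D 3 u)) q) + KG.D i u q := by
      unfold kgOp
      rw [D_add ((hs 0).fun_sub (((hs 1).fun_add (hs 2)).fun_add (hs 3)))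
        (hu.smooth.diffWithinAt_half hq) hq,
        D_sub (hs 0) (((hs 1).fun_add (hs 2)).fun_add (hs 3)) hq,
        D_add ((hs 1).fun_add (hs 2)) (hs 3) hq, D_add (hs 1) (hs 2) hq]
    rw [kgOp, D_D_D_comm hu.smooth hq, D_D_D_comm hu.smooth hq, D_D_D_comm hu.smooth hq,
      D_D_D_comm hu.smooth hq, ← h2, h0, h1]
  support q hq hs := by
    refine D_eq_zero_of_eventually ?_ hq
    have ho : IsOpen {p : Coord | (R + p 0) ^ 2 < p 1 ^ 2 + p 2 ^ 2} :=
      isOpen_lt (by fun_prop) (by fun_prop)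
    filter_upwards [self_mem_nhdsWithin, mem_nhdsWithin_of_mem_nhds (ho.mem_nhds hs)] with p hp hp'
    exact hu.support p hp hp'
  periodic q hq := D_periodic hu.periodic hq

end IsKGSol

/-- The Lorentz boost `x_i ∂_t + (t + c) ∂_i`. -/
def boost (c : ℝ) (i : Fin 4) (u : Coord → F) (q : Coord) : F :=
  (q i + 0) • D 0 u q + (q 0 + c) • D i u q

/-- Two commutator terms arise: ∂_t² acting on t + c gives 2 ∂_t ∂_i, and -∂_i² acting on x_i gives
-2 ∂_i ∂_t. They cancel, whatever c is. The direction y is excluded since the coefficient y would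
break periodicity. The `+ 0` in `boost` gives both coefficients the shape required by
`D_D_coord_smul`. -/
theorem IsKGSol.boost {R : ℝ} {u : Coord → F} (hu : IsKGSol R u) (c : ℝ) {i : Fin 4}
    (hi : i = 1 ∨ i = 2) : IsKGSol R (boost c i u) where
  smooth := ((contDiffOn_coord 0 i).smul (contDiffOn_D hu.smooth 0)).add
    ((contDiffOn_coord c 0).smul (contDiffOn_D hu.smooth i))
  equation q hq := by
    have h0 := (hu.D 0).equation q hq
    have hi' := (hu.D i).equation q hq
    have s0 := contDiffOn_D hu.smooth 0
    have si := contDiffOn_D hu.smooth i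
    unfold kgOp at h0 hi' ⊢
    unfold KG.boost
    have e : ∀ j, KG.D j (KG.D j (fun p => (p i + 0) • KG.D 0 u p + (p 0 + c) • KG.D i u p)) q
        = ((if j = i then (2 : ℝ) else 0) • KG.D j (KG.D 0 u) q
            + (q i + 0) • KG.D j (KG.D j (KG.D 0 u)) q)
          + ((if j = 0 then (2 : ℝ) else 0) • KG.D j (KG.D i u) q
            + (q 0 + c) • KG.D j (KG.D j (KG.D i u)) q) := fun j => by
      rw [D_D_add (contDiffOn_coord_smul 0 i s0) (contDiffOn_coord_smul c 0 si) hq,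
        D_D_coord_smul 0 s0 hq, D_D_coord_smul c si hq]
    rw [e 0, e 1, e 2, e 3]
    have key := congrArg₂ (· + ·) (congrArg ((q i + 0) • ·) h0) (congrArg ((q 0 + c) • ·) hi')
    simp only [smul_zero, add_zero] at key
    rw [← key]
    rcases hi with rfl | rfl
    · rw [D_comm (i := 0) (j := 1) hu.smooth hq]
      simp
      module
    · rw [D_comm (i := 0) (j := 2) hu.smooth hq]
      simp
      module
  support q hq hs := by
    rw [KG.boost, (hu.D 0).support q hq hs, (hu.D i).support q hq hs]
    simp
  periodic q hq := by
    have : i ≠ 3 := by rcases hi with rfl | rfl <;> decide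
    rw [KG.boost, KG.boost, (hu.D 0).periodic q hq, (hu.D i).periodic q hq]
    simp [this]

end

/-! ### Divergence theorem and energy current -/

/-- **Divergence theorem** on a box in `t ≥ 0`, for a vector field which vanishes on the faces
`x₁ = const`, `x₂ = const` and is `2π`-periodic in `y`. -/
theorem integral_div_eq {Y : Fin 4 → Coord → ℝ} {a b : Coord} (ha : 0 ≤ a 0) (hab : a ≤ b)
    (hY : ∀ i, DifferentiableOn ℝ (Y i) half)
    (hc : ContinuousOn (fun q => ∑ i, D i (Y i) q) (Icc a b))
    (h1 : ∀ q ∈ Icc a b, q 1 = a 1 ∨ q 1 = b 1 → Y 1 q = 0)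
    (h2 : ∀ q ∈ Icc a b, q 2 = a 2 ∨ q 2 = b 2 → Y 2 q = 0)
    (hb : b 3 = a 3 + 2 * Real.pi)
    (h3 : ∀ q ∈ half, Y 3 (q + Pi.single 3 (2 * Real.pi)) = Y 3 q) :
    ∫ q in Icc a b, ∑ i, D i (Y i) q
      = (∫ z in Icc (fun i : Fin 3 => a i.succ) (fun i => b i.succ), Y 0 (Fin.cons (b 0) z))
        - ∫ z in Icc (fun i : Fin 3 => a i.succ) (fun i => b i.succ), Y 0 (Fin.cons (a 0) z) := by
  have hsub : Icc a b ⊆ half := fun q hq => ha.trans (hq.1 0)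
  have key := integral_divergence_of_hasFDerivAt_off_countable' a b hab Y
    (fun i q => fderivWithin ℝ (Y i) half q) ∅ countable_empty
    (fun i => (hY i).continuousOn.mono hsub)
    (fun q hq i => by
      have h0 : 0 < q 0 := ha.trans_lt (hq.1 0 (mem_univ _)).1
      exact (hY i q h0.le).hasFDerivWithinAt.hasFDerivAt (half_mem_nhds h0))
    (hc.integrableOn_compact isCompact_Icc)
  have mem : ∀ (i : Fin 4) (c : ℝ), c ∈ Icc (a i) (b i) → ∀ z ∈ Icc (a ∘ i.succAbove)
      (b ∘ i.succAbove), (i.insertNth c z : Coord) ∈ Icc a b := fun i c hc z hz => by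
    rw [Fin.insertNth_mem_Icc]; exact ⟨hc, hz⟩
  have z1 : ∀ c, c = a 1 ∨ c = b 1 → ∫ z in Icc (a ∘ (1 : Fin 4).succAbove)
      (b ∘ (1 : Fin 4).succAbove), Y 1 ((1 : Fin 4).insertNth c z : Coord) = 0 := fun c hc =>
    setIntegral_eq_zero_of_forall_eq_zero fun z hz =>
      h1 _ (mem 1 c (by rcases hc with rfl | rfl <;> simp [hab 1]) z hz) (by simpa using hc)
  have z2 : ∀ c, c = a 2 ∨ c = b 2 → ∫ z in Icc (a ∘ (2 : Fin 4).succAbove)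
      (b ∘ (2 : Fin 4).succAbove), Y 2 ((2 : Fin 4).insertNth c z : Coord) = 0 := fun c hc =>
    setIntegral_eq_zero_of_forall_eq_zero fun z hz =>
      h2 _ (mem 2 c (by rcases hc with rfl | rfl <;> simp [hab 2]) z hz) (by simpa using hc)
  have z3 : ∫ z in Icc (a ∘ (3 : Fin 4).succAbove) (b ∘ (3 : Fin 4).succAbove),
        Y 3 ((3 : Fin 4).insertNth (b 3) z : Coord)
      = ∫ z in Icc (a ∘ (3 : Fin 4).succAbove) (b ∘ (3 : Fin 4).succAbove),
        Y 3 ((3 : Fin 4).insertNth (a 3) z : Coord) := by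
    refine setIntegral_congr_fun measurableSet_Icc fun z hz => ?_
    have hm := mem 3 (a 3) (by simp [hab 3]) z hz
    have : ((3 : Fin 4).insertNth (b 3) z : Coord)
        = ((3 : Fin 4).insertNth (a 3) z : Coord) + Pi.single 3 (2 * Real.pi) := by
      funext i
      refine Fin.succAboveCases 3 ?_ (fun j => ?_) i
      · simp [hb]
      · simp [Fin.succAbove_ne]
    change Y 3 _ = Y 3 _
    rw [this, h3 _ (hsub hm)]
  rw [Fin.sum_univ_four, z1 _ (.inl rfl), z1 _ (.inr rfl), z2 _ (.inl rfl), z2 _ (.inr rfl), z3]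
    at key
  simp only [sub_self, add_zero, Fin.insertNth_zero'] at key
  exact key

/-- The components of the energy current: `2 × ` energy density for `i = 0`, energy flux else. -/
def current (u : Coord → ℝ) (i : Fin 4) (q : Coord) : ℝ :=
  if i = 0 then D 0 u q * D 0 u q + D 1 u q * D 1 u q + D 2 u q * D 2 u q + D 3 u q * D 3 u q
    + u q * u q
  else (-2) * (D 0 u q * D i u q)

section current

variable {u : Coord → ℝ} {q : Coord}

theorem contDiffOn_current (hu : ContDiffOn ℝ ∞ u half) (i : Fin 4) :
    ContDiffOn ℝ ∞ (current u i) half := by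
  have h := contDiffOn_D hu
  unfold current
  split_ifs
  · exact ((((((h 0).mul (h 0)).add ((h 1).mul (h 1))).add ((h 2).mul (h 2))).add
      ((h 3).mul (h 3))).add (hu.mul hu))
  · exact contDiffOn_const.mul ((h 0).mul (h i))

/-- This is the identity of the multiplier 2 ∂_t u: the terms ∂_i u ∂_t ∂_i u coming from the
density cancel against those coming from the fluxes. -/
theorem div_current (hu : ContDiffOn ℝ ∞ u half) (hq : q ∈ half) :
    ∑ i, D i (current u i) q = 2 * D 0 u q * kgOp u q := by
  have h := fun i => (contDiffOn_D hu i).diffWithinAt_half hq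
  have h' := hu.diffWithinAt_half hq
  have e0 : D 0 (current u 0) q = 2 * (D 0 u q * D 0 (D 0 u) q + D 1 u q * D 0 (D 1 u) q
      + D 2 u q * D 0 (D 2 u) q + D 3 u q * D 0 (D 3 u) q + u q * D 0 u q) := by
    have : current u 0 = fun q => D 0 u q * D 0 u q + D 1 u q * D 1 u q + D 2 u q * D 2 u q
      + D 3 u q * D 3 u q + u q * u q := by funext q; simp [current]
    have m := fun i => (h i).fun_mul (h i)
    rw [this, D_add ((((m 0).fun_add (m 1)).fun_add (m 2)).fun_add (m 3)) (h'.fun_mul h') hq,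
      D_add (((m 0).fun_add (m 1)).fun_add (m 2)) (m 3) hq,
      D_add ((m 0).fun_add (m 1)) (m 2) hq, D_add (m 0) (m 1) hq, D_mul (h 0) (h 0) hq,
      D_mul (h 1) (h 1) hq, D_mul (h 2) (h 2) hq, D_mul (h 3) (h 3) hq, D_mul h' h' hq]
    ring
  have ei : ∀ i ≠ 0, D i (current u i) q
      = -2 * (D i (D 0 u) q * D i u q + D 0 u q * D i (D i u) q) := by
    intro i hi
    have : current u i = fun q => (-2 : ℝ) • (D 0 u q * D i u q) := by
      funext q; simp [current, hi]
    rw [this, D_const_smul _ ((h 0).fun_mul (h i)) hq, D_mul (h 0) (h i) hq, smul_eq_mul]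
  rw [Fin.sum_univ_four, e0, ei 1 (by decide), ei 2 (by decide), ei 3 (by decide),
    D_comm (i := 0) (j := 1) hu hq, D_comm (i := 0) (j := 2) hu hq,
    D_comm (i := 0) (j := 3) hu hq, kgOp]
  ring

theorem current_periodic (hp : ∀ p ∈ half, u (p + Pi.single 3 (2 * Real.pi)) = u p)
    (hq : q ∈ half) (i : Fin 4) :
    current u i (q + Pi.single 3 (2 * Real.pi)) = current u i q := by
  simp only [current, D_periodic hp hq, hp q hq]

/-- The energy density dominates the flux through spacelike directions. -/
theorem energy_sub_flux_ge {ρ ξ η : ℝ} (hρ : 0 ≤ ρ) (h : ξ ^ 2 + η ^ 2 ≤ ρ ^ 2) (a b c : ℝ) :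
    0 ≤ ρ * (a * a + b * b + c * c) + 2 * (ξ * (a * b) + η * (a * c)) := by
  have h1 : (ξ * b + η * c) ^ 2 ≤ ρ ^ 2 * (b ^ 2 + c ^ 2) := by
    nlinarith [sq_nonneg (ξ * c - η * b), sq_nonneg b, sq_nonneg c,
      mul_le_mul_of_nonneg_right h (add_nonneg (sq_nonneg b) (sq_nonneg c))]
  have h2 : |ξ * b + η * c| ≤ ρ * Real.sqrt (b ^ 2 + c ^ 2) := by
    rw [← Real.sqrt_sq hρ, ← Real.sqrt_mul (sq_nonneg ρ)]
    exact Real.abs_le_sqrt h1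
  have h3 := Real.sq_sqrt (add_nonneg (sq_nonneg b) (sq_nonneg c))
  have h4 : |a * (ξ * b + η * c)| ≤ |a| * (ρ * Real.sqrt (b ^ 2 + c ^ 2)) := by
    rw [abs_mul]; gcongr
  have h5 := neg_abs_le (a * (ξ * b + η * c))
  nlinarith [mul_nonneg hρ (sq_nonneg (|a| - Real.sqrt (b ^ 2 + c ^ 2))), sq_abs a]

end current

/-! ### Finite speed of propagation -/

theorem hasDerivAt_max_zero_sq (z : ℝ) : HasDerivAt (fun z => max z 0 ^ 2) (2 * max z 0) z := by
  rcases lt_trichotomy z 0 with h | rfl | h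
  · rw [max_eq_right h.le, mul_zero]
    refine (hasDerivAt_const z (0 : ℝ)).congr_of_eventuallyEq ?_
    filter_upwards [Iio_mem_nhds h] with y hy
    simp [max_eq_right (mem_Iio.1 hy).le]
  · rw [hasDerivAt_iff_isLittleO_nhds_zero]
    simp only [zero_add, max_self, mul_zero, smul_zero, sub_zero, ne_eq, OfNat.ofNat_ne_zero,
      not_false_eq_true, zero_pow]
    have : (fun h : ℝ => max h 0 ^ 2) =O[nhds 0] fun h => h ^ 2 := by
      refine Asymptotics.isBigO_of_le _ fun x => ?_
      rw [norm_pow, norm_pow]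
      gcongr
      rcases le_total x 0 with hx | hx <;> simp [hx]
    exact this.trans_isLittleO (Asymptotics.isLittleO_pow_id one_lt_two)
  · rw [max_eq_left h.le]
    have := (hasDerivAt_pow 2 z)
    simp only [Nat.cast_ofNat, Nat.add_one_sub_one, pow_one] at this
    refine this.congr_of_eventuallyEq ?_
    filter_upwards [Ioi_mem_nhds h] with y hy
    simp [max_eq_left (mem_Ioi.1 hy).le]

/-- The function `(r - t)² - |x - x₀|²`, positive inside the light cone with base `|x - x₀| < r`. -/
def cone (r c₁ c₂ : ℝ) (q : Coord) : ℝ := (r - q 0) ^ 2 - (q 1 - c₁) ^ 2 - (q 2 - c₂) ^ 2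

/-- The weight `max (cone) 0 ^ 2`. -/
def weight (r c₁ c₂ : ℝ) (q : Coord) : ℝ := max (cone r c₁ c₂ q) 0 ^ 2

section cone

variable {r c₁ c₂ : ℝ} {q : Coord}

theorem hasFDerivAt_cone : HasFDerivAt (cone r c₁ c₂)
    ((-(2 * (r - q 0))) • ContinuousLinearMap.proj (R := ℝ) (φ := fun _ : Fin 4 => ℝ) 0
      - (2 * (q 1 - c₁)) • ContinuousLinearMap.proj (R := ℝ) (φ := fun _ : Fin 4 => ℝ) 1
      - (2 * (q 2 - c₂)) • ContinuousLinearMap.proj (R := ℝ) (φ := fun _ : Fin 4 => ℝ) 2) q := by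
  have p := fun i => (ContinuousLinearMap.proj (R := ℝ) (φ := fun _ : Fin 4 => ℝ) i).hasFDerivAt
    (x := q)
  have h := ((((p 0).const_sub r).pow 2).sub (((p 1).sub_const c₁).pow 2)).sub
    (((p 2).sub_const c₂).pow 2)
  refine h.congr_fderiv ?_
  ext i
  simp

theorem hasFDerivAt_weight : HasFDerivAt (weight r c₁ c₂)
    ((2 * max (cone r c₁ c₂ q) 0) •
    ((-(2 * (r - q 0))) • ContinuousLinearMap.proj (R := ℝ) (φ := fun _ : Fin 4 => ℝ) 0
      - (2 * (q 1 - c₁)) • ContinuousLinearMap.proj (R := ℝ) (φ := fun _ : Fin 4 => ℝ) 1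
      - (2 * (q 2 - c₂)) • ContinuousLinearMap.proj (R := ℝ) (φ := fun _ : Fin 4 => ℝ) 2)) q :=
  (hasDerivAt_max_zero_sq _).comp_hasFDerivAt q hasFDerivAt_cone

theorem D_weight (hq : q ∈ half) (i : Fin 4) : D i (weight r c₁ c₂) q
    = 2 * max (cone r c₁ c₂ q) 0 * (-(2 * (r - q 0)) * (if i = 0 then 1 else 0)
      - 2 * (q 1 - c₁) * (if i = 1 then 1 else 0) - 2 * (q 2 - c₂) * (if i = 2 then 1 else 0)) := by
  rw [D, hasFDerivAt_weight.hasFDerivWithinAt.fderivWithin (uniqueDiffOn_half q hq)]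
  simp [Pi.single_apply, eq_comm]

theorem continuous_cone : Continuous (cone r c₁ c₂) := by unfold cone; fun_prop

theorem continuous_weight : Continuous (weight r c₁ c₂) := by
  unfold weight; exact (continuous_cone.max continuous_const).pow 2

end cone

/-- The integrand vanishes almost everywhere, hence everywhere by continuity: the box is the closure
of its interior, which is where the strict inequalities `hab` enter. -/
theorem eq_zero_of_setIntegral_nonpos {n : ℕ} {a b : Fin n → ℝ} (hab : ∀ i, a i < b i)
    {f : (Fin n → ℝ) → ℝ} (hf : ContinuousOn f (Icc a b)) (h0 : ∀ x ∈ Icc a b, 0 ≤ f x)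
    (hi : ∫ x in Icc a b, f x ≤ 0) {x : Fin n → ℝ} (hx : x ∈ Icc a b) : f x = 0 := by
  have hint := hf.integrableOn_compact (μ := volume) isCompact_Icc
  have hae : 0 ≤ᵐ[volume.restrict (Icc a b)] f :=
    (ae_restrict_iff' measurableSet_Icc).2 (.of_forall h0)
  have h1 := (setIntegral_eq_zero_iff_of_nonneg_ae hae hint).1
    (hi.antisymm (setIntegral_nonneg measurableSet_Icc h0))
  refine Measure.eqOn_of_ae_eq (g := fun _ => 0) h1 hf continuousOn_const ?_ hx
  rw [← pi_univ_Icc, interior_pi_set finite_univ]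
  simp only [interior_Icc]
  rw [closure_pi_set]
  simp only [fun i => closure_Ioo (hab i).ne]
  exact subset_rfl

/-- Smooth solutions of the Klein–Gordon equation have finite speed of propagation. -/
theorem eq_zero_of_initial_eq_zero {u : Coord → ℝ} (hu : ContDiffOn ℝ ∞ u half)
    (heq : ∀ q ∈ half, kgOp u q = 0)
    (hper : ∀ q ∈ half, u (q + Pi.single 3 (2 * Real.pi)) = u q) {q₀ : Coord} (hq₀ : q₀ ∈ half)
    {r : ℝ} (hr : q₀ 0 < r)
    (hdata : ∀ q : Coord, q 0 = 0 → (q 1 - q₀ 1) ^ 2 + (q 2 - q₀ 2) ^ 2 < r ^ 2 →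
      current u 0 q = 0) : u q₀ = 0 := by
  have hq0 : 0 ≤ q₀ 0 := hq₀
  have hr0 : 0 < r := hq0.trans_lt hr
  -- Multiplying the current by this weight replaces the divergence theorem on a cone by one on a
  -- box. Squaring the positive part makes the weight differentiable with continuous derivative.
  set w := weight r (q₀ 1) (q₀ 2) with hw
  set a : Coord := ![0, q₀ 1 - r, q₀ 2 - r, q₀ 3] with ha
  set b : Coord := ![q₀ 0, q₀ 1 + r, q₀ 2 + r, q₀ 3 + 2 * Real.pi] with hb
  have hpi := Real.two_pi_pos
  have hab : a ≤ b := by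
    intro i
    fin_cases i <;> simp [ha, hb] <;> linarith
  have hsub : Icc a b ⊆ half := fun q hq => hq.1 0
  have hcd := contDiffOn_current hu
  have hdw : ∀ q, DifferentiableAt ℝ w q := fun q => hasFDerivAt_weight.differentiableAt
  have hdiv : EqOn (fun q => ∑ i, D i (fun p => w p * current u i p) q)
      (fun q => ∑ i, D i w q * current u i q) half := by
    intro q hq
    have e : ∀ i, D i (fun p => w p * current u i p) q
        = D i w q * current u i q + w q * D i (current u i) q := fun i =>
      D_mul (hdw q).differentiableWithinAt ((hcd i).diffWithinAt_half hq) hq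
    simp only [e, Finset.sum_add_distrib, ← Finset.mul_sum, div_current hu hq, heq q hq]
    ring
  have hcont : ContinuousOn (fun q => ∑ i, D i w q * current u i q) half := by
    refine continuousOn_finsetSum _ fun i _ => ContinuousOn.mul ?_ (hcd i).continuousOn
    refine ContinuousOn.congr ?_ (fun q hq => D_weight hq i)
    refine Continuous.continuousOn ?_
    have := continuous_cone (r := r) (c₁ := q₀ 1) (c₂ := q₀ 2)
    fun_prop
  have hw1 : ∀ q ∈ Icc a b, (q 1 - q₀ 1) ^ 2 = r ^ 2 ∨ (q 2 - q₀ 2) ^ 2 = r ^ 2 → w q = 0 := by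
    intro q hq h
    have h1 : 0 ≤ q 0 := hsub hq
    have h2 : q 0 ≤ q₀ 0 := hq.2 0
    have : cone r (q₀ 1) (q₀ 2) q ≤ 0 := by
      unfold cone
      rcases h with h | h <;> nlinarith [sq_nonneg (q 1 - q₀ 1), sq_nonneg (q 2 - q₀ 2)]
    simp [hw, weight, this]
  have key := integral_div_eq (Y := fun i p => w p * current u i p) (a := a) (b := b)
    (by simp [ha]) hab
    (fun i q hq => (hdw q).differentiableWithinAt.mul ((hcd i).diffWithinAt_half hq))
    ((hcont.congr hdiv).mono hsub)
    (fun q hq h => by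
      rw [hw1 q hq (.inl _), zero_mul]
      rcases h with h | h <;> simp [h, ha, hb])
    (fun q hq h => by
      rw [hw1 q hq (.inr _), zero_mul]
      rcases h with h | h <;> simp [h, ha, hb])
    (by simp [ha, hb])
    (fun q hq => by
      simp only [current_periodic hper hq]
      congr 1
      simp [hw, weight, cone])
  -- Only the derivative of the weight contributes. Inside the cone it is twice the cone function
  -- times a timelike covector with negative time component, so its pairing with the current is
  -- nonpositive.
  have hneg : ∫ q in Icc a b, ∑ i, D i (fun p => w p * current u i p) q ≤ 0 := by
    refine setIntegral_nonpos measurableSet_Icc fun q hq => ?_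
    refine (hdiv (hsub hq)).trans_le ?_
    simp only [Fin.sum_univ_four, D_weight (hsub hq), hw]
    have h2 : q 0 ≤ q₀ 0 := hq.2 0
    rcases le_or_gt (cone r (q₀ 1) (q₀ 2) q) 0 with h | h
    · simp [max_eq_right h]
    · rw [max_eq_left h.le]
      have hh : (2 * (q 1 - q₀ 1)) ^ 2 + (2 * (q 2 - q₀ 2)) ^ 2 ≤ (2 * (r - q 0)) ^ 2 := by
        unfold cone at h; nlinarith
      have := energy_sub_flux_ge (by linarith : 0 ≤ 2 * (r - q 0))
        (ξ := - (2 * (q 1 - q₀ 1))) (η := - (2 * (q 2 - q₀ 2))) (by simpa using hh)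
        (D 0 u q) (D 1 u q) (D 2 u q)
      have ne : ∀ i j : Fin 4, (i = j) = ((i : ℕ) = j) := fun i j => by simp [Fin.ext_iff]
      simp only [current, ne, Fin.val_zero, Fin.val_one, Fin.val_two,
        show ((3 : Fin 4) : ℕ) = 3 from rfl]
      norm_num
      have h3 : 0 ≤ (r - q 0) * (D 3 u q * D 3 u q + u q * u q) :=
        mul_nonneg (by linarith) (add_nonneg (mul_self_nonneg _) (mul_self_nonneg _))
      have h4 := mul_nonneg h.le (add_nonneg this (mul_nonneg zero_le_two h3))
      linarith
  have hzero : ∫ z in Icc (fun i : Fin 3 => a i.succ) (fun i => b i.succ),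
      (fun p => w p * current u 0 p) (Fin.cons (a 0) z) = 0 := by
    refine setIntegral_eq_zero_of_forall_eq_zero fun z _ => ?_
    rcases le_or_gt (cone r (q₀ 1) (q₀ 2) (Fin.cons (a 0) z)) 0 with h | h
    · simp [hw, weight, h]
    · simp only
      rw [hdata (Fin.cons (a 0) z) rfl, mul_zero]
      have e0 : (Fin.cons (a 0) z : Coord) 0 = 0 := rfl
      rw [cone, e0] at h
      linarith
  -- The weighted energy at the time of `q₀` is thus at most 0, while its integrand is nonnegative;
  -- it therefore vanishes at `q₀`, where the weight is positive because r exceeds that time.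
  rw [key, hzero, sub_zero] at hneg
  have hcons : Continuous (fun z : Fin 3 → ℝ => (Fin.cons (b 0) z : Coord)) := by
    fun_prop
  have hres := eq_zero_of_setIntegral_nonpos (a := fun i : Fin 3 => a i.succ)
    (b := fun i => b i.succ)
    (by intro i; fin_cases i <;> simp [ha, hb] <;> linarith)
    (((continuous_weight.continuousOn.mul (hcd 0).continuousOn).comp hcons.continuousOn
      (fun z _ => show 0 ≤ b 0 by simpa [hb] using hq0)))
    (fun z _ => mul_nonneg (sq_nonneg _) (by
      simp only [current, if_true]
      have := fun x : ℝ => mul_self_nonneg x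
      exact add_nonneg (add_nonneg (add_nonneg (add_nonneg (this _) (this _)) (this _)) (this _))
        (this _)))
    hneg (x := fun i => q₀ i.succ)
    ⟨by intro i; fin_cases i <;> simp [ha] <;> linarith,
      by intro i; fin_cases i <;> simp [hb] <;> linarith⟩
  have e : (Fin.cons (b 0) fun i : Fin 3 => q₀ i.succ : Coord) = q₀ := by
    rw [show b 0 = q₀ 0 from rfl]
    exact Fin.cons_self_tail q₀
  have hwp : weight r (q₀ 1) (q₀ 2) q₀ ≠ 0 := by
    have : 0 < cone r (q₀ 1) (q₀ 2) q₀ := by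
      unfold cone; simp; exact pow_pos (by linarith) 2
    simp [weight, this.le, this.ne']
  simp only [Function.comp, e] at hres
  have hE := (mul_eq_zero.1 hres).resolve_left hwp
  simp only [current, if_true] at hE
  nlinarith [mul_self_nonneg (D 0 u q₀), mul_self_nonneg (D 1 u q₀), mul_self_nonneg (D 2 u q₀),
    mul_self_nonneg (D 3 u q₀), mul_self_nonneg (u q₀)]

/-! ### Energy on hyperboloids -/

/-- The time `√(σ + |x|²)` at which the hyperboloid `t² - |x|² = σ` lies above `x`. -/
def hypTime (σ : ℝ) (q : Coord) : ℝ := Real.sqrt (σ + q 1 ^ 2 + q 2 ^ 2)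

/-- Fibrewise rescaling of time, mapping `[0, 1] × ℝ² × ℝ` onto the region between `t = 0` and the
hyperboloid `(t + c)² - |x|² = σ`. -/
def squeeze (σ c : ℝ) (q : Coord) : Coord :=
  q + Pi.single 0 (q 0 * (hypTime σ q - c) - q 0)

section hyperboloid

variable {σ c : ℝ} {q : Coord}

theorem hypTime_arg_pos (hσ : 0 < σ) : 0 < σ + q 1 ^ 2 + q 2 ^ 2 := by positivity

theorem hypTime_pos (hσ : 0 < σ) : 0 < hypTime σ q := Real.sqrt_pos.2 (hypTime_arg_pos hσ)

theorem sq_hypTime (hσ : 0 < σ) : hypTime σ q ^ 2 = σ + q 1 ^ 2 + q 2 ^ 2 :=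
  Real.sq_sqrt (hypTime_arg_pos hσ).le

theorem contDiff_hypTime (hσ : 0 < σ) : ContDiff ℝ ∞ (hypTime σ) := by
  unfold hypTime
  exact ContDiff.sqrt (by fun_prop) fun q => (hypTime_arg_pos hσ).ne'

theorem le_hypTime (hc : c ^ 2 < σ) : c < hypTime σ q :=
  Real.lt_sqrt_of_sq_lt (by nlinarith [sq_nonneg (q 1), sq_nonneg (q 2)])

theorem D_hypTime (hσ : 0 < σ) (hq : q ∈ half) (i : Fin 4) : D i (hypTime σ) q =
    (q 1 / hypTime σ q) * (if i = 1 then 1 else 0)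
      + (q 2 / hypTime σ q) * (if i = 2 then 1 else 0) := by
  have h := (contDiff_hypTime hσ).contDiffOn.diffWithinAt_half hq
  have x := fun j => (contDiffOn_coord 0 j).diffWithinAt_half hq
  have h1 : EqOn (fun q => hypTime σ q * hypTime σ q)
      (fun q => (q 1 + 0) * (q 1 + 0) + (q 2 + 0) * (q 2 + 0) - (-σ)) half := fun p _ => by
    simp only [← sq, sq_hypTime hσ]; ring
  have h2 := D_congr (i := i) h1 hq
  rw [D_mul h h hq, D_sub (((x 1).fun_mul (x 1)).fun_add ((x 2).fun_mul (x 2)))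
    (differentiableWithinAt_const _) hq, D_add ((x 1).fun_mul (x 1)) ((x 2).fun_mul (x 2)) hq,
    D_mul (x 1) (x 1) hq, D_mul (x 2) (x 2) hq, D_coord 0 hq, D_coord 0 hq,
    show D i (fun _ => -σ) q = 0 by simp [D]] at h2
  have h3 := (hypTime_pos (q := q) hσ).ne'
  refine mul_left_cancel₀ h3 ?_
  rw [mul_add, ← mul_assoc, ← mul_assoc, mul_div_cancel₀ _ h3, mul_div_cancel₀ _ h3]
  linarith

theorem contDiff_slope (hσ : 0 < σ) (i : Fin 4) :
    ContDiff ℝ ∞ (fun q : Coord => q i / hypTime σ q) :=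
  (contDiff_apply ℝ ℝ i).div (contDiff_hypTime hσ) fun _ => (hypTime_pos hσ).ne'

theorem D_zero_slope (hσ : 0 < σ) (hq : q ∈ half) {i : Fin 4} (hi : i ≠ 0) :
    D 0 (fun q : Coord => q i / hypTime σ q) q = 0 := by
  have h1 : EqOn (fun q : Coord => q i / hypTime σ q * hypTime σ q) (fun q => q i + 0) half :=
    fun p _ => by simp [(hypTime_pos hσ).ne']
  have h2 := D_congr (i := 0) h1 hq
  rw [D_mul ((contDiff_slope hσ i).contDiffOn.diffWithinAt_half hq)
    ((contDiff_hypTime hσ).contDiffOn.diffWithinAt_half hq) hq, D_coord 0 hq, D_hypTime hσ hq,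
    if_neg hi.symm] at h2
  simpa [(hypTime_pos hσ).ne'] using h2

/-- The slope of the hyperboloid is at most 1, so its conormal is causal. This is the hypothesis of
`energy_sub_flux_ge` with ρ = 1. -/
theorem slope_sq_le (hσ : 0 < σ) : (q 1 / hypTime σ q) ^ 2 + (q 2 / hypTime σ q) ^ 2 ≤ 1 ^ 2 := by
  rw [div_pow, div_pow, ← add_div, sq_hypTime hσ, div_le_iff₀ (hypTime_arg_pos hσ)]
  linarith

@[simp] theorem squeeze_zero : squeeze σ c q 0 = q 0 * (hypTime σ q - c) := by simp [squeeze]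

@[simp] theorem squeeze_of_ne {i : Fin 4} (hi : i ≠ 0) : squeeze σ c q i = q i := by
  simp [squeeze, hi]

theorem squeeze_mem_half (hc : c ^ 2 < σ) (hq : q ∈ half) : squeeze σ c q ∈ half := by
  change 0 ≤ squeeze σ c q 0
  rw [squeeze_zero]
  exact mul_nonneg hq (sub_nonneg.2 (le_hypTime hc).le)

theorem contDiff_squeeze (hσ : 0 < σ) : ContDiff ℝ ∞ (squeeze σ c) := by
  unfold squeeze
  have h1 := contDiff_hypTime hσ
  have h2 : ContDiff ℝ ∞ (fun q : Coord => q 0) := contDiff_apply ℝ ℝ 0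
  exact contDiff_id.add ((ContinuousLinearMap.single ℝ (fun _ : Fin 4 => ℝ) 0).contDiff.comp
    ((h2.mul (h1.sub contDiff_const)).sub h2))

theorem contDiffOn_comp_squeeze (hσ : 0 < σ) (hc : c ^ 2 < σ) {v : Coord → ℝ}
    (hv : ContDiffOn ℝ ∞ v half) : ContDiffOn ℝ ∞ (fun q => v (squeeze σ c q)) half :=
  hv.comp (contDiff_squeeze hσ).contDiffOn fun _ hq => squeeze_mem_half hc hq

/-- The map `squeeze` alters only the time coordinate, so the chain rule differs from the identity
by a multiple of ∂_t alone. -/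
theorem D_comp_squeeze (hσ : 0 < σ) (hc : c ^ 2 < σ) {v : Coord → ℝ} (hv : ContDiffOn ℝ ∞ v half)
    (hq : q ∈ half) (i : Fin 4) :
    D i (fun q => v (squeeze σ c q)) q = D i v (squeeze σ c q)
      + (D i (fun q => q 0 * (hypTime σ q - c)) q - if i = 0 then 1 else 0)
        * D 0 v (squeeze σ c q) := by
  have h2 : ContDiff ℝ ∞ (fun q : Coord => q 0) := contDiff_apply ℝ ℝ 0
  have hρ : ContDiff ℝ ∞ (fun q : Coord => q 0 * (hypTime σ q - c)) :=
    h2.mul ((contDiff_hypTime hσ).sub contDiff_const)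
  have hρ' := ((hρ.differentiable (by simp)) q).differentiableWithinAt (s := half)
    |>.hasFDerivWithinAt
  have p0 := (ContinuousLinearMap.proj (R := ℝ) (φ := fun _ : Fin 4 => ℝ) 0).hasFDerivWithinAt
    (x := q) (s := half)
  have hΦ : HasFDerivWithinAt (squeeze σ c) _ half q := (hasFDerivWithinAt_id q half).add
    ((ContinuousLinearMap.single ℝ (fun _ : Fin 4 => ℝ) 0).hasFDerivAt.comp_hasFDerivWithinAt q
      (hρ'.sub p0))
  have hv' := (hv.diffWithinAt_half (squeeze_mem_half hc hq)).hasFDerivWithinAt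
  have hcomp := hv'.comp q hΦ fun _ hp => squeeze_mem_half hc hp
  rw [D, show (fun q => v (squeeze σ c q)) = v ∘ squeeze σ c from rfl,
    hcomp.fderivWithin (uniqueDiffOn_half q hq)]
  have e : ∀ x : ℝ, fderivWithin ℝ v half (squeeze σ c q) (Pi.single 0 x)
      = x * D 0 v (squeeze σ c q) := fun x => by
    rw [D, ← smul_eq_mul, ← map_smul, ← Pi.single_smul, smul_eq_mul, mul_one]
  simp only [ContinuousLinearMap.comp_apply, _root_.add_apply, _root_.sub_apply,
    ContinuousLinearMap.single_apply, map_add, e, ContinuousLinearMap.id_apply,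
    ContinuousLinearMap.proj_apply]
  simp [D, Pi.single_apply, eq_comm]

theorem D_height (hσ : 0 < σ) (hq : q ∈ half) (i : Fin 4) :
    D i (fun q => q 0 * (hypTime σ q - c)) q =
      (if i = 0 then 1 else 0) * (hypTime σ q - c) + q 0 * D i (hypTime σ) q := by
  have h1 := (contDiff_hypTime hσ).contDiffOn.diffWithinAt_half hq
  have h2 := D_coord (i := i) (j := 0) 0 hq
  simp only [add_zero] at h2
  have h3 : DifferentiableWithinAt ℝ (fun q : Coord => q 0) half q := by fun_prop
  rw [D_mul h3 (h1.fun_sub (differentiableWithinAt_const c)) hq, h2,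
    D_sub h1 (differentiableWithinAt_const c) hq]
  simp [D]

end hyperboloid

/-- The box `|x₁|, |x₂| ≤ M`, `0 ≤ y ≤ 2π`. -/
def spaceBox (M : ℝ) : Set (Fin 3 → ℝ) := Icc ![-M, -M, 0] ![M, M, 2 * Real.pi]

/-- The point of the hyperboloid `(t + c)² - |x|² = σ` above `(x₁, x₂, y)`. -/
def hypPoint (σ c : ℝ) (z : Fin 3 → ℝ) : Coord := squeeze σ c (Fin.cons 1 z)

theorem hypPoint_mem_half {σ c : ℝ} (hc : c ^ 2 < σ) (z : Fin 3 → ℝ) : hypPoint σ c z ∈ half :=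
  squeeze_mem_half hc (show (0 : ℝ) ≤ 1 by norm_num)

theorem contDiff_hypPoint {σ c : ℝ} (hσ : 0 < σ) : ContDiff ℝ ∞ (hypPoint σ c) := by
  have : ContDiff ℝ ∞ (fun z : Fin 3 → ℝ => (Fin.cons 1 z : Coord)) := by
    refine contDiff_pi.2 fun i => ?_
    refine Fin.cases ?_ (fun j => ?_) i
    · exact contDiff_const
    · exact contDiff_apply ℝ ℝ j
  exact (contDiff_squeeze hσ).comp this

theorem contDiff_comp_hypPoint {σ c : ℝ} (hσ : 0 < σ) (hc : c ^ 2 < σ) {v : Coord → ℝ}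
    (hv : ContDiffOn ℝ ∞ v half) : ContDiff ℝ ∞ (fun z => v (hypPoint σ c z)) :=
  contDiffOn_univ.1 (hv.comp (contDiff_hypPoint hσ).contDiffOn
    fun z _ => hypPoint_mem_half hc z)

/-- The choice c = R + 1 leaves a gap: below the hyperboloid R + t ≤ T - 1, and (T - 1)² = |x|² + σ
+ 1 - 2T is less than |x|² as soon as T ≥ M ≥ σ + 1. The lateral faces of the box therefore lie off
the support. -/
theorem add_squeeze_sq_lt {R σ M : ℝ} {q : Coord} (hR : 0 ≤ R) (hσ : (R + 1) ^ 2 < σ)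
    (hM : σ + 1 ≤ M) (hq0 : 0 ≤ q 0) (hq1 : q 0 ≤ 1) (h : M ^ 2 ≤ q 1 ^ 2 + q 2 ^ 2) :
    (R + squeeze σ (R + 1) q 0) ^ 2 < q 1 ^ 2 + q 2 ^ 2 := by
  have hσ0 : 0 < σ := (sq_nonneg _).trans_lt hσ
  rw [squeeze_zero]
  have h1 := le_hypTime (q := q) hσ
  have h2 := sq_hypTime (q := q) hσ0
  have h3 : 0 ≤ q 0 * (hypTime σ q - (R + 1)) := mul_nonneg hq0 (by linarith)
  have h4 : q 0 * (hypTime σ q - (R + 1)) ≤ hypTime σ q - (R + 1) :=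
    mul_le_of_le_one_left (by linarith) hq1
  have h5 : (R + q 0 * (hypTime σ q - (R + 1))) ^ 2 ≤ (hypTime σ q - 1) ^ 2 := by
    apply pow_le_pow_left₀ (by linarith); linarith
  have h6 : M ≤ hypTime σ q := le_of_sq_le_sq (by nlinarith) (hypTime_pos hσ0).le
  nlinarith

theorem IsKGSol.current_eq_zero {R : ℝ} {u : Coord → ℝ} (hu : IsKGSol R u) {q : Coord}
    (hq : q ∈ half) (h : (R + q 0) ^ 2 < q 1 ^ 2 + q 2 ^ 2) (i : Fin 4) : current u i q = 0 := by
  simp [current, (hu.D _).support q hq h, hu.support q hq h]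

theorem spaceBox_mem_iff {M : ℝ} {z : Fin 3 → ℝ} : z ∈ spaceBox M ↔
    (-M ≤ z 0 ∧ z 0 ≤ M) ∧ (-M ≤ z 1 ∧ z 1 ≤ M) ∧ (0 ≤ z 2 ∧ z 2 ≤ 2 * Real.pi) := by
  simp only [spaceBox, mem_Icc, Pi.le_def, Fin.forall_fin_succ]
  simp
  tauto

/-- On the hyperboloids `(t + R + 1)² - |x|² = σ` the energy is bounded by the initial energy. -/
theorem hyperboloid_energy_le {R : ℝ} {u : Coord → ℝ} (hu : IsKGSol R u) (hR : 0 ≤ R)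
    {σ M : ℝ} (hσ : (R + 1) ^ 2 < σ) (hM : σ + 1 ≤ M) :
    ∫ z in spaceBox M, u (hypPoint σ (R + 1) z) ^ 2
      ≤ ∫ z in spaceBox M, current u 0 (Fin.cons 0 z) := by
  have hσ0 : 0 < σ := (sq_nonneg _).trans_lt hσ
  set c := R + 1 with hc
  set X := current u with hX
  have hXs : ∀ i, ContDiffOn ℝ ∞ (X i) half := contDiffOn_current hu.smooth
  let P : Fin 4 → Coord → ℝ := fun i q => X i (squeeze σ c q)
  have hPs : ∀ i, ContDiffOn ℝ ∞ (P i) half := fun i => contDiffOn_comp_squeeze hσ0 hσ (hXs i)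
  have hTs : ContDiffOn ℝ ∞ (fun q : Coord => hypTime σ q - c) half :=
    ((contDiff_hypTime hσ0).sub contDiff_const).contDiffOn
  have hss : ∀ i, ContDiffOn ℝ ∞ (fun q : Coord => q i / hypTime σ q) half := fun i =>
    (contDiff_slope hσ0 i).contDiffOn
  have hq0s : ContDiffOn ℝ ∞ (fun q : Coord => q 0) half := (contDiff_apply ℝ ℝ 0).contDiffOn
  let S : Fin 4 → Coord → ℝ := fun i q => q 0 * (q i / hypTime σ q * P i q)
  have hSs : ∀ i, ContDiffOn ℝ ∞ (S i) half := fun i => hq0s.mul ((hss i).mul (hPs i))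
  -- This is the Piola transform of the current under `squeeze`, whose Jacobian determinant is T -
  -- c. Its divergence is T - c times the divergence of the current at the image point, hence 0. The
  -- last face carries the flux through the hyperboloid.
  let Y : Fin 4 → Coord → ℝ := fun i q => if i = 0 then P 0 q - S 1 q - S 2 q
    else (hypTime σ q - c) * P i q
  have hYs : ∀ i, ContDiffOn ℝ ∞ (Y i) half := by
    intro i
    by_cases hi : i = 0
    · simp only [Y, hi, if_true]; exact ((hPs 0).sub (hSs 1)).sub (hSs 2)
    · simp only [Y, hi, if_false]; exact hTs.mul (hPs i)
  have hdiv : ∀ q ∈ half, ∑ i, D i (Y i) q = 0 := by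
    intro q hq
    have hP := fun i => (hPs i).diffWithinAt_half hq
    have hS := fun i => (hSs i).diffWithinAt_half hq
    have hs := fun i => (hss i).diffWithinAt_half hq
    have hT := hTs.diffWithinAt_half hq
    have hz : DifferentiableWithinAt ℝ (fun q : Coord => q 0) half q := hq0s.diffWithinAt_half hq
    have dz : D 0 (fun q : Coord => q 0) q = 1 := by
      simpa using D_coord (i := 0) (j := 0) 0 hq
    have dP := fun i j => D_comp_squeeze (i := j) hσ0 hσ (hXs i) hq
    have dT : ∀ i, D i (fun q => hypTime σ q - c) q = D i (hypTime σ) q := fun i => by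
      rw [D_sub ((contDiff_hypTime hσ0).contDiffOn.diffWithinAt_half hq)
        (differentiableWithinAt_const c) hq]
      simp [D]
    have dS : ∀ i ≠ 0, D 0 (S i) q = q i / hypTime σ q * P i q
        + q 0 * (q i / hypTime σ q * D 0 (P i) q) := fun i hi => by
      simp only [S]
      rw [D_mul hz ((hs i).fun_mul (hP i)) hq, D_mul (hs i) (hP i) hq, D_zero_slope hσ0 hq hi, dz]
      ring
    have d0 : D 0 (Y 0) q = D 0 (P 0) q - D 0 (S 1) q - D 0 (S 2) q := by
      simp only [Y, if_true]
      rw [D_sub ((hP 0).fun_sub (hS 1)) (hS 2) hq, D_sub (hP 0) (hS 1) hq]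
    have di : ∀ i ≠ 0, D i (Y i) q
        = D i (hypTime σ) q * P i q + (hypTime σ q - c) * D i (P i) q := fun i hi => by
      simp only [Y, hi, if_false]
      rw [D_mul hT (hP i) hq, dT]
    have hX0 : ∑ i, D i (X i) (squeeze σ c q) = 0 := by
      rw [hX, div_current hu.smooth (squeeze_mem_half hσ hq),
        hu.equation _ (squeeze_mem_half hσ hq), mul_zero]
    rw [Fin.sum_univ_four] at hX0
    rw [Fin.sum_univ_four, d0, dS 1 (by decide), dS 2 (by decide), di 1 (by decide),
      di 2 (by decide), di 3 (by decide)]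
    simp only [P, dP, D_height hσ0 hq, D_hypTime hσ0 hq]
    have ne : ∀ i j : Fin 4, (i = j) = ((i : ℕ) = j) := fun i j => by simp [Fin.ext_iff]
    simp only [ne, Fin.val_zero, Fin.val_one, Fin.val_two, show ((3 : Fin 4) : ℕ) = 3 from rfl]
    norm_num
    linear_combination (hypTime σ q - c) * hX0
  set a : Coord := ![0, -M, -M, 0] with ha
  set b : Coord := ![1, M, M, 2 * Real.pi] with hb
  have hsub : Icc a b ⊆ half := fun q hq => hq.1 0
  have hpi := Real.two_pi_pos
  have hab : a ≤ b := by
    intro i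
    fin_cases i <;> simp [ha, hb] <;> linarith
  have hlat : ∀ q ∈ Icc a b, q 1 ^ 2 = M ^ 2 ∨ q 2 ^ 2 = M ^ 2 → ∀ i, P i q = 0 := by
    intro q hq h i
    refine hu.current_eq_zero (squeeze_mem_half hσ (hsub hq)) ?_ i
    have := add_squeeze_sq_lt (q := q) hR hσ hM (hq.1 0) (hq.2 0)
      (by rcases h with h | h <;> nlinarith [sq_nonneg (q 1), sq_nonneg (q 2)])
    simpa using this
  have key := integral_div_eq (Y := Y) (a := a) (b := b) (by simp [ha]) hab
    (fun i => (hYs i).differentiableOn (by simp))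
    ((continuousOn_const (c := (0 : ℝ))).congr fun q hq => hdiv q (hsub hq))
    (fun q hq h => by
      simp only [Y]
      rw [hlat q hq (.inl (by rcases h with h | h <;> simp [h, ha, hb])) 1]
      simp)
    (fun q hq h => by
      simp only [Y]
      rw [hlat q hq (.inr (by rcases h with h | h <;> simp [h, ha, hb])) 2]
      simp)
    (by simp [ha, hb])
    (fun q hq => by
      have e : hypTime σ (q + Pi.single 3 (2 * Real.pi)) = hypTime σ q := by
        simp [hypTime]
      have e2 : squeeze σ c (q + Pi.single 3 (2 * Real.pi))
          = squeeze σ c q + Pi.single 3 (2 * Real.pi) := by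
        simp only [squeeze, e]
        simp
        abel
      simp only [Y, P, e, e2, hX, current_periodic hu.periodic (squeeze_mem_half hσ hq)]
      simp)
  have hbox : Icc (fun i : Fin 3 => a i.succ) (fun i => b i.succ) = spaceBox M := by
    have h1 : (fun i : Fin 3 => a i.succ) = ![-M, -M, 0] := by
      funext i; fin_cases i <;> rfl
    have h2 : (fun i : Fin 3 => b i.succ) = ![M, M, 2 * Real.pi] := by
      funext i; fin_cases i <;> rfl
    rw [h1, h2, spaceBox]
  rw [setIntegral_eq_zero_of_forall_eq_zero fun q hq => hdiv q (hsub hq), hbox] at key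
  have h0 : ∫ z in spaceBox M, Y 0 (Fin.cons (a 0) z)
      = ∫ z in spaceBox M, current u 0 (Fin.cons 0 z) := by
    congr 1
    funext z
    have e0 : (Fin.cons (a 0) z : Coord) 0 = 0 := rfl
    simp only [Y, S, P, e0, if_true, zero_mul, sub_zero, hX]
    congr 1
    simp [squeeze, ha]
  rw [← h0, ← sub_eq_zero.1 key.symm]
  have hcons : ContDiff ℝ ∞ (fun z : Fin 3 → ℝ => (Fin.cons (b 0) z : Coord)) := by
    refine contDiff_pi.2 fun i => ?_
    refine Fin.cases ?_ (fun j => ?_) i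
    · exact contDiff_const
    · exact contDiff_apply ℝ ℝ j
  refine setIntegral_mono_on
    ((((contDiff_comp_hypPoint hσ0 hσ hu.smooth).continuous.pow 2).continuousOn).integrableOn_compact
      isCompact_Icc)
    (((hYs 0).continuousOn.comp hcons.continuous.continuousOn
      fun z _ => show (0 : ℝ) ≤ 1 by norm_num).integrableOn_compact isCompact_Icc)
    measurableSet_Icc fun z _ => ?_
  have e0 : (Fin.cons (b 0) z : Coord) = Fin.cons 1 z := rfl
  have e1 : (Fin.cons 1 z : Coord) 0 = 1 := rfl
  simp only [Y, S, P, e0, e1, if_true, hX, one_mul]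
  rw [hypPoint]
  set p := (Fin.cons 1 z : Coord)
  -- The flux through the hyperboloid is u² + (∂_y u)² plus the quadratic form treated here, which
  -- is nonnegative because the conormal is causal.
  have := energy_sub_flux_ge zero_le_one (slope_sq_le (q := p) hσ0) (D 0 u (squeeze σ c p))
    (D 1 u (squeeze σ c p)) (D 2 u (squeeze σ c p))
  simp only [current, if_true, if_neg (by decide : (1 : Fin 4) ≠ 0),
    if_neg (by decide : (2 : Fin 4) ≠ 0)]
  linarith [mul_self_nonneg (D 3 u (squeeze σ c p)), sq (u (squeeze σ c p))]

/-- The initial energy over large boxes is bounded. -/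
theorem IsKGSol.exists_energy_bound {R : ℝ} {u : Coord → ℝ} (hu : IsKGSol R u) (hR : 0 ≤ R) :
    ∃ K : ℝ, 0 ≤ K ∧ ∀ σ M : ℝ, (R + 1) ^ 2 < σ → σ + 1 ≤ M →
      ∫ z in spaceBox M, u (hypPoint σ (R + 1) z) ^ 2 ≤ K := by
  have hnn : ∀ q, 0 ≤ current u 0 q := fun q => by
    simp only [current, if_true]
    have := fun x : ℝ => mul_self_nonneg x
    exact add_nonneg (add_nonneg (add_nonneg (add_nonneg (this _) (this _)) (this _)) (this _))
      (this _)
  -- At t = 0 the density vanishes for |x| > R, so all larger boxes give the same integral; this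
  -- makes the bound independent of σ and M.
  refine ⟨∫ z in spaceBox (R + 1), current u 0 (Fin.cons 0 z),
    setIntegral_nonneg measurableSet_Icc fun z _ => hnn _, fun σ M hσ hM => ?_⟩
  refine (hyperboloid_energy_le hu hR hσ hM).trans (le_of_eq ?_)
  refine (setIntegral_eq_of_subset_of_forall_sdiff_eq_zero measurableSet_Icc ?_ ?_)
  · have : R + 1 ≤ M := by nlinarith
    intro z hz
    rw [spaceBox_mem_iff] at hz ⊢
    refine ⟨⟨?_, ?_⟩, ⟨?_, ?_⟩, hz.2.2⟩ <;> linarith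
  · rintro z ⟨hz, hz'⟩
    refine hu.current_eq_zero (show (0 : ℝ) ≤ 0 from le_rfl) ?_ 0
    change (R + 0) ^ 2 < z 0 ^ 2 + z 1 ^ 2
    rw [spaceBox_mem_iff] at hz hz'
    by_contra! hcon
    refine hz' ⟨abs_le.1 ?_, abs_le.1 ?_, hz.2.2⟩ <;>
    · refine abs_le_of_sq_le_sq ?_ (by linarith)
      nlinarith [sq_nonneg (z 0), sq_nonneg (z 1)]

/-! ### Sobolev inequalities on the circle and on hyperboloids -/

/-- The points of `[-M, M]` which are at least as far from `0` as `a`. -/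
def outer (M a : ℝ) : Set ℝ := {x | |a| ≤ |x|} ∩ Icc (-M) M

theorem measurableSet_outer (M a : ℝ) : MeasurableSet (outer M a) :=
  (isClosed_le continuous_const continuous_abs).measurableSet.inter measurableSet_Icc

/-- Integrate the derivative from `a` to the end of the interval on the side away from 0, where `f`
vanishes. Staying at |x| ≥ |a| is what later keeps the weight 1/T no larger than at the point of
evaluation. -/
theorem enorm_le_lintegral_outer {f f' : ℝ → ℝ} (hf : ∀ x, HasDerivAt f (f' x) x)
    (hf' : Continuous f') {M a : ℝ} (ha : |a| ≤ M) (hl : f (-M) = 0) (hr : f M = 0) :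
    ‖f a‖ₑ ≤ ∫⁻ x in outer M a, ‖f' x‖ₑ := by
  obtain ⟨h1, h2⟩ := abs_le.1 ha
  rcases le_total 0 a with h | h
  · have := intervalIntegral.integral_eq_sub_of_hasDerivAt (fun x _ => hf x)
      (hf'.intervalIntegrable a M)
    rw [hr, zero_sub, intervalIntegral.integral_of_le h2] at this
    rw [← enorm_neg, ← this]
    refine (enorm_integral_le_lintegral_enorm _).trans (lintegral_mono_set fun x hx => ?_)
    refine ⟨?_, by linarith [hx.1], hx.2⟩
    change |a| ≤ |x|
    rw [abs_of_nonneg h, abs_of_nonneg (h.trans hx.1.le)]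
    exact hx.1.le
  · have := intervalIntegral.integral_eq_sub_of_hasDerivAt (fun x _ => hf x)
      (hf'.intervalIntegrable (-M) a)
    rw [hl, sub_zero, intervalIntegral.integral_of_le h1] at this
    rw [← this]
    refine (enorm_integral_le_lintegral_enorm _).trans (lintegral_mono_set fun x hx => ?_)
    refine ⟨?_, hx.1.le, by linarith [hx.2]⟩
    change |a| ≤ |x|
    rw [abs_of_nonpos h, abs_of_nonpos (hx.2.trans h)]
    linarith [hx.2]

/-- The minimum of f² is at most its integral because the interval has length 2π ≥ 1, and f² exceeds
its minimum by at most ∫ |2 f f'| ≤ ∫ (f² + f'²). -/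
theorem sq_le_integral_period {f f' : ℝ → ℝ} (hf : ∀ x, HasDerivAt f (f' x) x)
    (hf' : Continuous f') {y : ℝ} (hy : y ∈ Icc 0 (2 * Real.pi)) :
    f y ^ 2 ≤ ∫ x in Icc 0 (2 * Real.pi), (f x ^ 2 + f x ^ 2 + f' x ^ 2) := by
  have hpi : 1 ≤ 2 * Real.pi := by linarith [Real.pi_gt_three]
  have hpi0 : 0 ≤ 2 * Real.pi := by linarith
  have hfc : Continuous f := continuous_iff_continuousAt.2 fun x => (hf x).continuousAt
  obtain ⟨y₁, hy₁, hmin⟩ := isCompact_Icc.exists_isMinOn (nonempty_Icc.2 hpi0)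
    (f := fun x => f x ^ 2) (hfc.pow 2).continuousOn
  have hI : ∀ g : ℝ → ℝ, Continuous g → IntegrableOn g (Icc 0 (2 * Real.pi)) := fun g hg =>
    hg.integrableOn_Icc
  have h1 : f y₁ ^ 2 ≤ ∫ x in Icc 0 (2 * Real.pi), f x ^ 2 := by
    have h := setIntegral_mono_on (f := fun _ => f y₁ ^ 2) (g := fun x => f x ^ 2)
      (hI _ continuous_const) (hI _ (hfc.pow 2)) measurableSet_Icc fun x hx => hmin hx
    rw [setIntegral_const, smul_eq_mul, Real.volume_real_Icc_of_le hpi0, sub_zero] at h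
    nlinarith [sq_nonneg (f y₁)]
  have h2 : f y ^ 2 - f y₁ ^ 2 ≤ ∫ x in Icc 0 (2 * Real.pi), (f x ^ 2 + f' x ^ 2) := by
    have hd : ∀ x, HasDerivAt (fun x => f x ^ 2) (2 * f x * f' x) x := fun x => by
      simpa using (hf x).fun_pow 2
    have hdc : Continuous fun x => 2 * f x * f' x := by fun_prop
    rw [← intervalIntegral.integral_eq_sub_of_hasDerivAt (fun x _ => hd x)
      (hdc.intervalIntegrable _ _)]
    refine (Real.le_norm_self _).trans
      ((intervalIntegral.norm_integral_le_integral_norm_uIoc).trans ?_)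
    refine (setIntegral_mono_set (hI _ hdc.norm) (.of_forall fun _ => norm_nonneg _)
      (LE.le.eventuallyLE (uIoc_subset_uIcc.trans
        (uIcc_subset_Icc hy₁ hy)))).trans ?_
    refine setIntegral_mono_on (hI _ hdc.norm) (hI _ (by fun_prop)) measurableSet_Icc fun x _ => ?_
    rw [Real.norm_eq_abs]
    exact abs_le.2 ⟨by nlinarith [sq_nonneg (f x + f' x)], by nlinarith [sq_nonneg (f x - f' x)]⟩
  have h3 : ∫ x in Icc 0 (2 * Real.pi), (f x ^ 2 + f x ^ 2 + f' x ^ 2)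
      = (∫ x in Icc 0 (2 * Real.pi), f x ^ 2)
        + ∫ x in Icc 0 (2 * Real.pi), (f x ^ 2 + f' x ^ 2) := by
    rw [← integral_add (hI _ (by fun_prop)) (hI _ (by fun_prop))]
    simp only [add_assoc]
  linarith

theorem lintegral_pi_insertNth {n : ℕ} (μ : Fin (n + 1) → Measure ℝ) [∀ i, SigmaFinite (μ i)]
    (i : Fin (n + 1)) {f : (Fin (n + 1) → ℝ) → ℝ≥0∞} (hf : Measurable f) :
    ∫⁻ z, f z ∂Measure.pi μ
      = ∫⁻ s, ∫⁻ z, f (i.insertNth s z) ∂Measure.pi (fun j => μ (i.succAbove j)) ∂μ i := by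
  have h := (measurePreserving_piFinSuccAbove μ i).symm
  rw [← h.lintegral_comp hf, lintegral_prod (fun p => f ((MeasurableEquiv.piFinSuccAbove (fun _ => ℝ) i).symm p))
    (hf.comp h.measurable).aemeasurable]
  rfl

theorem measurable_insertNth {n : ℕ} (i : Fin (n + 1)) (s : ℝ) :
    Measurable fun z : Fin n → ℝ => (i.insertNth s z : Fin (n + 1) → ℝ) := by
  refine measurable_pi_iff.2 fun j => ?_
  refine Fin.succAboveCases i ?_ (fun k => ?_) j
  · simp
  · simpa using measurable_pi_apply k

theorem lintegral_spaceBox (M : ℝ) {f : (Fin 3 → ℝ) → ℝ≥0∞} (hf : Measurable f) :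
    ∫⁻ z in spaceBox M, f z = ∫⁻ y in Icc 0 (2 * Real.pi), ∫⁻ x₂ in Icc (-M) M,
      ∫⁻ x₁ in Icc (-M) M, f ![x₁, x₂, y] := by
  rw [spaceBox, ← pi_univ_Icc, volume_pi, Measure.restrict_pi_pi,
    lintegral_pi_insertNth _ 2 hf]
  refine lintegral_congr fun y => ?_
  rw [lintegral_pi_insertNth _ 1 (f := fun z => f (Fin.insertNth 2 y z))
    (hf.comp (measurable_insertNth 2 y))]
  refine lintegral_congr fun x₂ => ?_
  rw [lintegral_pi_insertNth _ 0 (f := fun z => f (Fin.insertNth 2 y (Fin.insertNth 1 x₂ z)))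
    (hf.comp ((measurable_insertNth 2 y).comp (measurable_insertNth 1 x₂)))]
  refine lintegral_congr fun x₁ => ?_
  rw [Measure.pi_of_empty, lintegral_dirac]
  congr 1
  funext i
  fin_cases i <;> rfl

/-- Partial derivatives in a direction tangent to the boundary, along coordinate lines. -/
theorem hasDerivAt_update_of_ne {F : Type*} [NormedAddCommGroup F] [NormedSpace ℝ F]
    {v : Coord → F} (hv : ContDiffOn ℝ ∞ v half) {q : Coord}
    (hq : q ∈ half) {j : Fin 4} (hj : j ≠ 0) (x : ℝ) :
    HasDerivAt (fun s => v (Function.update q j s)) (D j v (Function.update q j x)) x := by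
  have hm : ∀ s, Function.update q j s ∈ half := fun s => by
    change 0 ≤ Function.update q j s 0
    rw [Function.update_of_ne hj.symm]; exact hq
  exact ((hv.diffWithinAt_half (hm x)).hasFDerivWithinAt).comp_hasDerivAt x
    (hasDerivAt_update q j x) (.of_forall hm)

section sobolev

variable {σ c : ℝ} {w : Coord → ℝ}

theorem hypPoint_zero (σ c : ℝ) (z : Fin 3 → ℝ) :
    hypPoint σ c z 0 = Real.sqrt (σ + z 0 ^ 2 + z 1 ^ 2) - c :=
  (squeeze_zero).trans (one_mul _)

theorem hypPoint_succ (σ c : ℝ) (z : Fin 3 → ℝ) (i : Fin 3) : hypPoint σ c z i.succ = z i :=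
  squeeze_of_ne (Fin.succ_ne_zero i)

/-- On the hyperboloid the tangential derivative is ∂_i + (x_i / T) ∂_t, and T = t + c there, so it
equals T⁻¹ times the boost. -/
theorem D_comp_squeeze_eq_boost (hσ : 0 < σ) (hc : c ^ 2 < σ) (hw : ContDiffOn ℝ ∞ w half)
    {i : Fin 4} (hi : i = 1 ∨ i = 2) {q : Coord} (hq : q 0 = 1) :
    D i (fun q => w (squeeze σ c q)) q = boost c i w (squeeze σ c q) / hypTime σ q := by
  have hq' : q ∈ half := by change 0 ≤ q 0; rw [hq]; norm_num
  have hi0 : i ≠ 0 := by rcases hi with rfl | rfl <;> decide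
  have e : D i (hypTime σ) q = q i / hypTime σ q := by
    rw [D_hypTime hσ hq']
    rcases hi with rfl | rfl <;> simp
  have hT := (hypTime_pos (q := q) hσ).ne'
  rw [D_comp_squeeze hσ hc hw hq', D_height hσ hq', e, boost, squeeze_of_ne hi0, squeeze_zero, hq,
    if_neg hi0]
  simp only [smul_eq_mul]
  field_simp
  ring

theorem hasDerivAt_hyp_one (hσ : 0 < σ) (hc : c ^ 2 < σ) (hw : ContDiffOn ℝ ∞ w half)
    (x₁ x₂ y : ℝ) : HasDerivAt (fun s => w (hypPoint σ c ![s, x₂, y]))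
      (boost c 1 w (hypPoint σ c ![x₁, x₂, y]) / Real.sqrt (σ + x₁ ^ 2 + x₂ ^ 2)) x₁ := by
  have e : ∀ s, Function.update (![1, 0, x₂, y] : Coord) 1 s = Fin.cons 1 ![s, x₂, y] := fun s => by
    funext i; fin_cases i <;> rfl
  have h := hasDerivAt_update_of_ne (contDiffOn_comp_squeeze hσ hc hw)
    (q := ![1, 0, x₂, y]) (by change (0 : ℝ) ≤ 1; norm_num) (j := 1) (by decide) x₁
  simp only [e] at h
  rwa [D_comp_squeeze_eq_boost hσ hc hw (.inl rfl) rfl] at h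

theorem hasDerivAt_hyp_two (hσ : 0 < σ) (hc : c ^ 2 < σ) (hw : ContDiffOn ℝ ∞ w half)
    (x₁ x₂ y : ℝ) : HasDerivAt (fun s => w (hypPoint σ c ![x₁, s, y]))
      (boost c 2 w (hypPoint σ c ![x₁, x₂, y]) / Real.sqrt (σ + x₁ ^ 2 + x₂ ^ 2)) x₂ := by
  have e : ∀ s, Function.update (![1, x₁, 0, y] : Coord) 2 s = Fin.cons 1 ![x₁, s, y] := fun s => by
    funext i; fin_cases i <;> rfl
  have h := hasDerivAt_update_of_ne (contDiffOn_comp_squeeze hσ hc hw)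
    (q := ![1, x₁, 0, y]) (by change (0 : ℝ) ≤ 1; norm_num) (j := 2) (by decide) x₂
  simp only [e] at h
  rwa [D_comp_squeeze_eq_boost hσ hc hw (.inr rfl) rfl] at h

theorem hasDerivAt_hyp_three (hc : c ^ 2 < σ) (hw : ContDiffOn ℝ ∞ w half)
    (x₁ x₂ y : ℝ) : HasDerivAt (fun s => w (hypPoint σ c ![x₁, x₂, s]))
      (D 3 w (hypPoint σ c ![x₁, x₂, y])) y := by
  have e : ∀ s, Function.update (hypPoint σ c ![x₁, x₂, 0]) 3 s = hypPoint σ c ![x₁, x₂, s] := by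
    intro s
    funext i
    refine Fin.cases ?_ (fun j => ?_) i
    · rw [Function.update_of_ne (by decide), hypPoint_zero, hypPoint_zero]; rfl
    · rw [hypPoint_succ]
      fin_cases j
      · exact hypPoint_succ _ _ _ 0
      · exact hypPoint_succ _ _ _ 1
      · simp
  have h := hasDerivAt_update_of_ne hw (hypPoint_mem_half hc ![x₁, x₂, 0]) (j := 3) (by decide) y
  simpa only [e] using h

/-- The sum of squares of boosts of `w` controlling `w ^ 2` pointwise on hyperboloids. -/
def boostSq (c : ℝ) (w : Coord → ℝ) (q : Coord) : ℝ :=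
  w q ^ 2 + w q ^ 2 + boost c 1 w q ^ 2 + boost c 2 w q ^ 2 + boost c 2 w q ^ 2
    + boost c 1 (boost c 2 w) q ^ 2

/-- The left side is the mixed derivative of A² when ∂_1 A = B/T, ∂_2 A = C/T, ∂_1 C = E/T and ∂_1 T
= x/T. The products BC, AE and AC are split by 2ab ≤ a² + b²; this accounts for the multiplicities
in `boostSq`. -/
theorem abs_mixed_deriv_le {T x : ℝ} (hT : 0 < T) (hx : |x| ≤ T) (A B C E : ℝ) :
    |2 * (B / T) * (C / T) + 2 * A * ((E / T * T - C * (x / T)) / T ^ 2)|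
      ≤ (T ^ 2)⁻¹ * (A ^ 2 + A ^ 2 + B ^ 2 + C ^ 2 + C ^ 2 + E ^ 2) := by
  have e : 2 * (B / T) * (C / T) + 2 * A * ((E / T * T - C * (x / T)) / T ^ 2)
      = (T ^ 2)⁻¹ * (2 * (B * C + A * E - A * C * (x / T))) := by
    field_simp
    ring
  have hs : |x / T| ≤ 1 := by rwa [abs_div, abs_of_pos hT, div_le_one hT]
  have t1 : |A * C * (x / T)| ≤ |A * C| := by
    rw [abs_mul (A * C)]; exact mul_le_of_le_one_right (abs_nonneg _) hs
  have t2 : |A * C| ≤ (A ^ 2 + C ^ 2) / 2 :=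
    abs_le.2 ⟨by linarith [sq_nonneg (A + C)], by linarith [sq_nonneg (A - C)]⟩
  have t3 := abs_le.1 (t1.trans t2)
  rw [e, abs_mul, abs_of_pos (by positivity : 0 < (T ^ 2)⁻¹)]
  refine mul_le_mul_of_nonneg_left (abs_le.2 ⟨?_, ?_⟩) (by positivity)
  · linarith [sq_nonneg (B + C), sq_nonneg (A + E), t3.2]
  · linarith [sq_nonneg (B - C), sq_nonneg (A - E), t3.1]

/-- The one-dimensional bound is applied to g in x₂ and then to g₂ in x₁. The hypothesis on g₁₂ is
needed only on the outer set; enlarging to the full square comes last. -/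
theorem enorm_le_lintegral_mixed_deriv {g g₂ g₁₂ : ℝ → ℝ → ℝ} {M a₁ a₂ : ℝ}
    (hd2 : ∀ x₁ x₂, HasDerivAt (fun s => g x₁ s) (g₂ x₁ x₂) x₂)
    (hd12 : ∀ x₁ x₂, HasDerivAt (fun s => g₂ s x₂) (g₁₂ x₁ x₂) x₁)
    (c2 : ∀ x₁, Continuous (g₂ x₁)) (c12 : ∀ x₂, Continuous fun x₁ => g₁₂ x₁ x₂)
    (z2 : ∀ x₁, g x₁ (-M) = 0 ∧ g x₁ M = 0) (z1 : ∀ x₂, g₂ (-M) x₂ = 0 ∧ g₂ M x₂ = 0)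
    (h1 : |a₁| ≤ M) (h2 : |a₂| ≤ M) {K : ℝ≥0∞} (hK : K ≠ ⊤) {Q : ℝ → ℝ → ℝ≥0∞}
    (hQ : ∀ x₁ ∈ outer M a₁, ∀ x₂ ∈ outer M a₂, ‖g₁₂ x₁ x₂‖ₑ ≤ K * Q x₁ x₂) :
    ‖g a₁ a₂‖ₑ ≤ K * ∫⁻ x₂ in Icc (-M) M, ∫⁻ x₁ in Icc (-M) M, Q x₁ x₂ :=
  calc ‖g a₁ a₂‖ₑ ≤ ∫⁻ x₂ in outer M a₂, ‖g₂ a₁ x₂‖ₑ :=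
        enorm_le_lintegral_outer (hd2 a₁) (c2 a₁) h2 (z2 a₁).1 (z2 a₁).2
    _ ≤ ∫⁻ x₂ in outer M a₂, ∫⁻ x₁ in outer M a₁, ‖g₁₂ x₁ x₂‖ₑ :=
        lintegral_mono fun x₂ => enorm_le_lintegral_outer (f := fun s => g₂ s x₂)
          (fun x₁ => hd12 x₁ x₂) (c12 x₂) h1 (z1 x₂).1 (z1 x₂).2
    _ ≤ ∫⁻ x₂ in outer M a₂, ∫⁻ x₁ in outer M a₁, K * Q x₁ x₂ :=
        setLIntegral_mono' (measurableSet_outer _ _) fun x₂ hx₂ =>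
          setLIntegral_mono' (measurableSet_outer _ _) fun x₁ hx₁ => hQ x₁ hx₁ x₂ hx₂
    _ = K * ∫⁻ x₂ in outer M a₂, ∫⁻ x₁ in outer M a₁, Q x₁ x₂ := by
        rw [← lintegral_const_mul' _ _ hK]
        exact lintegral_congr fun x₂ => lintegral_const_mul' _ _ hK
    _ ≤ _ := by
        gcongr
        · exact inter_subset_right
        · exact inter_subset_right

/-- In the application A, B, C, E are w, L_1 w, L_2 w, L_1 L_2 w on a slice y = const of the
hyperboloid. The mixed derivative of A² carries T⁻², and on the outer set T² ≥ σ + a₁² + a₂², so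
that factor leaves the integral. -/
theorem sq_le_lintegral_weighted {A B C E : ℝ → ℝ → ℝ} {M a₁ a₂ : ℝ} (hσ : 0 < σ)
    (hA1 : ∀ x₁ x₂, HasDerivAt (fun s => A s x₂) (B x₁ x₂ / Real.sqrt (σ + x₁ ^ 2 + x₂ ^ 2)) x₁)
    (hA2 : ∀ x₁ x₂, HasDerivAt (fun s => A x₁ s) (C x₁ x₂ / Real.sqrt (σ + x₁ ^ 2 + x₂ ^ 2)) x₂)
    (hC1 : ∀ x₁ x₂, HasDerivAt (fun s => C s x₂) (E x₁ x₂ / Real.sqrt (σ + x₁ ^ 2 + x₂ ^ 2)) x₁)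
    (cA : Continuous (Function.uncurry A)) (cB : Continuous (Function.uncurry B))
    (cC : Continuous (Function.uncurry C)) (cE : Continuous (Function.uncurry E))
    (hzero : ∀ x₁ x₂, x₁ ^ 2 = M ^ 2 ∨ x₂ ^ 2 = M ^ 2 → A x₁ x₂ = 0)
    (h1 : |a₁| ≤ M) (h2 : |a₂| ≤ M) :
    ENNReal.ofReal (A a₁ a₂ ^ 2)
      ≤ ENNReal.ofReal ((σ + a₁ ^ 2 + a₂ ^ 2)⁻¹) * ∫⁻ x₂ in Icc (-M) M, ∫⁻ x₁ in Icc (-M) M,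
        ENNReal.ofReal (A x₁ x₂ ^ 2 + A x₁ x₂ ^ 2 + B x₁ x₂ ^ 2 + C x₁ x₂ ^ 2 + C x₁ x₂ ^ 2
          + E x₁ x₂ ^ 2) := by
  obtain ⟨T, hT⟩ : ∃ T : ℝ → ℝ → ℝ, T = fun x₁ x₂ : ℝ => Real.sqrt (σ + x₁ ^ 2 + x₂ ^ 2) := ⟨_, rfl⟩
  have hT' : ∀ x₁ x₂, Real.sqrt (σ + x₁ ^ 2 + x₂ ^ 2) = T x₁ x₂ := fun x₁ x₂ => by rw [hT]
  have hTpos : ∀ x₁ x₂, 0 < T x₁ x₂ := fun x₁ x₂ => by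
    rw [← hT']; exact Real.sqrt_pos.2 (by positivity)
  have hTsq : ∀ x₁ x₂, T x₁ x₂ ^ 2 = σ + x₁ ^ 2 + x₂ ^ 2 := fun x₁ x₂ => by
    rw [← hT']; exact Real.sq_sqrt (by positivity)
  have cT : Continuous (Function.uncurry T) := by 
    rw [hT]
    exact (by fun_prop : Continuous fun p : ℝ × ℝ => Real.sqrt (σ + p.1 ^ 2 + p.2 ^ 2))
  have hdT : ∀ x₁ x₂, HasDerivAt (fun s => T s x₂) (x₁ / T x₁ x₂) x₁ := fun x₁ x₂ => by
    have := ((((hasDerivAt_pow 2 x₁).const_add σ).add_const (x₂ ^ 2))).sqrt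
      (by positivity : σ + x₁ ^ 2 + x₂ ^ 2 ≠ 0)
    simp only [hT'] at this
    refine this.congr_deriv ?_
    simp [mul_div_mul_left]
  simp only [hT'] at hA1 hA2 hC1
  have row : ∀ {v : ℝ → ℝ → ℝ}, Continuous (Function.uncurry v) → ∀ x₁, Continuous (v x₁) :=
    fun hv x₁ => hv.comp (by fun_prop : Continuous fun s : ℝ => (x₁, s))
  have col : ∀ {v : ℝ → ℝ → ℝ}, Continuous (Function.uncurry v) → ∀ x₂, Continuous fun s => v s x₂ :=
    fun hv x₂ => hv.comp (by fun_prop : Continuous fun s : ℝ => (s, x₂))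
  have hMsq : (-M) ^ 2 = M ^ 2 := by ring
  rw [← Real.enorm_eq_ofReal (sq_nonneg _)]
  refine enorm_le_lintegral_mixed_deriv (g := fun x₁ x₂ => A x₁ x₂ ^ 2)
    (g₂ := fun x₁ x₂ => 2 * A x₁ x₂ * (C x₁ x₂ / T x₁ x₂))
    (g₁₂ := fun x₁ x₂ => 2 * (B x₁ x₂ / T x₁ x₂) * (C x₁ x₂ / T x₁ x₂)
      + 2 * A x₁ x₂ * ((E x₁ x₂ / T x₁ x₂ * T x₁ x₂ - C x₁ x₂ * (x₁ / T x₁ x₂)) / T x₁ x₂ ^ 2))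
    (fun x₁ x₂ => by simpa using (hA2 x₁ x₂).fun_pow 2)
    (fun x₁ x₂ => ((hA1 x₁ x₂).const_mul 2).mul
      ((hC1 x₁ x₂).div (hdT x₁ x₂) (hTpos x₁ x₂).ne'))
    (fun x₁ => (continuous_const.mul (row cA x₁)).mul
      ((row cC x₁).div (row cT x₁) fun _ => (hTpos _ _).ne'))
    (fun x₂ => ?_)
    (fun x₁ => ⟨by simp [hzero _ _ (.inr hMsq)], by simp [hzero _ _ (.inr rfl)]⟩)
    (fun x₂ => ⟨by simp [hzero _ _ (.inl hMsq)], by simp [hzero _ _ (.inl rfl)]⟩)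
    h1 h2 ENNReal.ofReal_ne_top fun x₁ hx₁ x₂ hx₂ => ?_
  · have d := fun {v : ℝ → ℝ} (hv : Continuous v) =>
      hv.div (col cT x₂) fun s => (hTpos s x₂).ne'
    exact ((continuous_const.mul (d (col cB x₂))).mul (d (col cC x₂))).add
      ((continuous_const.mul (col cA x₂)).mul ((((d (col cE x₂)).mul (col cT x₂)).sub
        ((col cC x₂).mul (d continuous_id))).div ((col cT x₂).pow 2)
          fun s => pow_ne_zero 2 (hTpos s x₂).ne'))
  · have hle : σ + a₁ ^ 2 + a₂ ^ 2 ≤ T x₁ x₂ ^ 2 := by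
      rw [hTsq]
      have e1 := sq_le_sq.2 (show |a₁| ≤ |x₁| from hx₁.1)
      have e2 := sq_le_sq.2 (show |a₂| ≤ |x₂| from hx₂.1)
      linarith
    have hs : |x₁| ≤ T x₁ x₂ :=
      abs_le_of_sq_le_sq (by rw [hTsq]; nlinarith [sq_nonneg x₂]) (hTpos _ _).le
    rw [← ENNReal.ofReal_mul (by positivity), Real.enorm_eq_ofReal_abs]
    refine ENNReal.ofReal_le_ofReal ((abs_mixed_deriv_le (hTpos x₁ x₂) hs _ _ _ _).trans ?_)
    exact mul_le_mul_of_nonneg_right (inv_anti₀ (by positivity) hle) (by positivity)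

theorem sq_le_lintegral_boostSq {R M : ℝ} (hw : IsKGSol R w) (hR : 0 ≤ R)
    (hσ : (R + 1) ^ 2 < σ) (hM : σ + 1 ≤ M) {a₁ a₂ : ℝ} (h1 : |a₁| ≤ M) (h2 : |a₂| ≤ M) (y : ℝ) :
    ENNReal.ofReal (w (hypPoint σ (R + 1) ![a₁, a₂, y]) ^ 2)
      ≤ ENNReal.ofReal ((σ + a₁ ^ 2 + a₂ ^ 2)⁻¹) * ∫⁻ x₂ in Icc (-M) M, ∫⁻ x₁ in Icc (-M) M,
        ENNReal.ofReal (boostSq (R + 1) w (hypPoint σ (R + 1) ![x₁, x₂, y])) := by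
  have hσ0 : 0 < σ := (sq_nonneg _).trans_lt hσ
  have hL1 := hw.boost (R + 1) (.inl rfl : (1 : Fin 4) = 1 ∨ (1 : Fin 4) = 2)
  have hL2 := hw.boost (R + 1) (.inr rfl : (2 : Fin 4) = 1 ∨ (2 : Fin 4) = 2)
  have hL12 := hL2.boost (R + 1) (.inl rfl : (1 : Fin 4) = 1 ∨ (1 : Fin 4) = 2)
  have hcont : ∀ {v : Coord → ℝ}, IsKGSol R v →
      Continuous (Function.uncurry fun x₁ x₂ : ℝ => v (hypPoint σ (R + 1) ![x₁, x₂, y])) :=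
    fun hv => (contDiff_comp_hypPoint hσ0 hσ hv.smooth).continuous.comp
      (by fun_prop : Continuous fun p : ℝ × ℝ => ![p.1, p.2, y])
  have hzero : ∀ x₁ x₂, x₁ ^ 2 = M ^ 2 ∨ x₂ ^ 2 = M ^ 2 →
      w (hypPoint σ (R + 1) ![x₁, x₂, y]) = 0 := by
    intro x₁ x₂ h
    have hle : M ^ 2 ≤ x₁ ^ 2 + x₂ ^ 2 := by
      rcases h with h | h <;> nlinarith [sq_nonneg x₁, sq_nonneg x₂]
    have := add_squeeze_sq_lt (q := Fin.cons 1 ![x₁, x₂, y]) hR hσ hM zero_le_one le_rfl hle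
    refine hw.support _ (hypPoint_mem_half hσ _) (this.trans_eq ?_)
    rw [show hypPoint σ (R + 1) ![x₁, x₂, y] 1 = x₁ from hypPoint_succ _ _ _ 0,
      show hypPoint σ (R + 1) ![x₁, x₂, y] 2 = x₂ from hypPoint_succ _ _ _ 1]
    rfl
  exact sq_le_lintegral_weighted hσ0
    (fun x₁ x₂ => hasDerivAt_hyp_one hσ0 hσ hw.smooth x₁ x₂ y)
    (fun x₁ x₂ => hasDerivAt_hyp_two hσ0 hσ hw.smooth x₁ x₂ y)
    (fun x₁ x₂ => hasDerivAt_hyp_one hσ0 hσ hL2.smooth x₁ x₂ y)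
    (hcont hw) (hcont hL1) (hcont hL2) (hcont hL12) hzero h1 h2

/-- Klainerman–Sobolev estimate on hyperboloids. -/
theorem sq_le_integral_boostSq {R M : ℝ} (hw : IsKGSol R w) (hR : 0 ≤ R)
    (hσ : (R + 1) ^ 2 < σ) (hM : σ + 1 ≤ M) {a₁ a₂ y : ℝ} (h1 : |a₁| ≤ M) (h2 : |a₂| ≤ M)
    (hy : y ∈ Icc 0 (2 * Real.pi)) :
    w (hypPoint σ (R + 1) ![a₁, a₂, y]) ^ 2 ≤ (σ + a₁ ^ 2 + a₂ ^ 2)⁻¹ *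
      ∫ z in spaceBox M, (boostSq (R + 1) w (hypPoint σ (R + 1) z)
        + boostSq (R + 1) w (hypPoint σ (R + 1) z)
        + boostSq (R + 1) (D 3 w) (hypPoint σ (R + 1) z)) := by
  have hσ0 : 0 < σ := (sq_nonneg _).trans_lt hσ
  set c := R + 1 with hc
  have hcont : ∀ {v : Coord → ℝ}, IsKGSol R v → Continuous fun z => v (hypPoint σ c z) :=
    fun hv => (contDiff_comp_hypPoint hσ0 hσ hv.smooth).continuous
  have hcB : ∀ {v : Coord → ℝ}, IsKGSol R v → Continuous fun z => boostSq c v (hypPoint σ c z) := by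
    intro v hv
    have hL1 := hcont (hv.boost c (.inl rfl : (1 : Fin 4) = 1 ∨ (1 : Fin 4) = 2))
    have hL2' := hv.boost c (.inr rfl : (2 : Fin 4) = 1 ∨ (2 : Fin 4) = 2)
    have hL2 := hcont hL2'
    have hL12 := hcont (hL2'.boost c (.inl rfl : (1 : Fin 4) = 1 ∨ (1 : Fin 4) = 2))
    have hv' := hcont hv
    exact (((((hv'.pow 2).add (hv'.pow 2)).add (hL1.pow 2)).add (hL2.pow 2)).add
      (hL2.pow 2)).add (hL12.pow 2)
  have hnn : ∀ v q, 0 ≤ boostSq c v q := fun v q => by unfold boostSq; positivity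
  have hK : 0 ≤ (σ + a₁ ^ 2 + a₂ ^ 2)⁻¹ := by positivity
  have hw3 := hw.D 3
  have hQc : Continuous fun z => boostSq c w (hypPoint σ c z) + boostSq c w (hypPoint σ c z)
      + boostSq c (D 3 w) (hypPoint σ c z) := ((hcB hw).add (hcB hw)).add (hcB hw3)
  have hQnn : ∀ z, 0 ≤ boostSq c w (hypPoint σ c z) + boostSq c w (hypPoint σ c z)
      + boostSq c (D 3 w) (hypPoint σ c z) := fun z =>
    add_nonneg (add_nonneg (hnn _ _) (hnn _ _)) (hnn _ _)
  have hQi : IntegrableOn (fun z => boostSq c w (hypPoint σ c z) + boostSq c w (hypPoint σ c z)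
      + boostSq c (D 3 w) (hypPoint σ c z)) (spaceBox M) :=
    hQc.continuousOn.integrableOn_compact isCompact_Icc
  have hline : Continuous fun s : ℝ => ![a₁, a₂, s] := by fun_prop
  have cw : Continuous fun s => w (hypPoint σ c ![a₁, a₂, s]) := (hcont hw).comp hline
  have cw3 : Continuous fun s => D 3 w (hypPoint σ c ![a₁, a₂, s]) := (hcont hw3).comp hline
  have hSi : IntegrableOn (fun s => w (hypPoint σ c ![a₁, a₂, s]) ^ 2
      + w (hypPoint σ c ![a₁, a₂, s]) ^ 2 + D 3 w (hypPoint σ c ![a₁, a₂, s]) ^ 2)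
      (Icc 0 (2 * Real.pi)) :=
    (((cw.pow 2).add (cw.pow 2)).add (cw3.pow 2)).integrableOn_Icc
  -- The circle inequality bounds w² by integrals over y of 2 w² + (∂_y w)² above the fixed point
  -- (a₁, a₂); the planar inequality is then applied to w and to ∂_y w on each slice.
  have step := sq_le_integral_period (fun s => hasDerivAt_hyp_three hσ hw.smooth a₁ a₂ s) cw3 hy
  rw [← ENNReal.ofReal_le_ofReal_iff (mul_nonneg hK (integral_nonneg hQnn)), ENNReal.ofReal_mul hK,
    ofReal_integral_eq_lintegral_ofReal hQi (.of_forall hQnn), lintegral_spaceBox M hQc.measurable.ennreal_ofReal]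
  refine (ENNReal.ofReal_le_ofReal step).trans ?_
  rw [ofReal_integral_eq_lintegral_ofReal
    hSi
    (.of_forall fun s => by positivity),
    ← lintegral_const_mul' _ _ ENNReal.ofReal_ne_top]
  refine lintegral_mono fun s => ?_
  have b1 := sq_le_lintegral_boostSq hw hR hσ hM h1 h2 s
  have b3 := sq_le_lintegral_boostSq hw3 hR hσ hM h1 h2 s
  rw [ENNReal.ofReal_add (by positivity) (by positivity),
    ENNReal.ofReal_add (by positivity) (by positivity)]
  refine (add_le_add (add_le_add b1 b1) b3).trans ?_
  rw [← mul_add, ← mul_add]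
  gcongr
  -- The sums are collected under the iterated integral by superadditivity of the lower integral,
  -- which needs no measurability.
  refine (add_le_add_left (le_lintegral_add _ _) _).trans ((le_lintegral_add _ _).trans ?_)
  refine lintegral_mono fun x₂ => ?_
  refine (add_le_add_left (le_lintegral_add _ _) _).trans ((le_lintegral_add _ _).trans ?_)
  refine lintegral_mono fun x₁ => ?_
  simp only
  rw [← ENNReal.ofReal_add (hnn _ _) (hnn _ _),
    ← ENNReal.ofReal_add (add_nonneg (hnn _ _) (hnn _ _)) (hnn _ _)]

end sobolev

/-! ### Pointwise decay of solutions in coordinates -/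

section

variable {R : ℝ} {u : Coord → ℝ}

/-- Each function squared in `boostSq` is itself a solution with the same R, so its square integral
over hyperboloids is bounded by its own initial energy. -/
theorem exists_boostSq_bound (hu : IsKGSol R u) (hR : 0 ≤ R) :
    ∃ K : ℝ, 0 ≤ K ∧ ∀ σ M : ℝ, (R + 1) ^ 2 < σ → σ + 1 ≤ M →
      IntegrableOn (fun z => boostSq (R + 1) u (hypPoint σ (R + 1) z)) (spaceBox M) ∧
      ∫ z in spaceBox M, boostSq (R + 1) u (hypPoint σ (R + 1) z) ≤ K := by
  have h1 := hu.boost (R + 1) (.inl rfl : (1 : Fin 4) = 1 ∨ (1 : Fin 4) = 2)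
  have h2 := hu.boost (R + 1) (.inr rfl : (2 : Fin 4) = 1 ∨ (2 : Fin 4) = 2)
  have h12 := h2.boost (R + 1) (.inl rfl : (1 : Fin 4) = 1 ∨ (1 : Fin 4) = 2)
  obtain ⟨K₀, p₀, b₀⟩ := hu.exists_energy_bound hR
  obtain ⟨K₁, p₁, b₁⟩ := h1.exists_energy_bound hR
  obtain ⟨K₂, p₂, b₂⟩ := h2.exists_energy_bound hR
  obtain ⟨K₃, p₃, b₃⟩ := h12.exists_energy_bound hR
  refine ⟨K₀ + K₀ + K₁ + K₂ + K₂ + K₃, by positivity, fun σ M hσ hM => ?_⟩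
  have hσ0 : 0 < σ := (sq_nonneg _).trans_lt hσ
  have hi : ∀ {v : Coord → ℝ}, IsKGSol R v →
      Integrable (fun z => v (hypPoint σ (R + 1) z) ^ 2) (volume.restrict (spaceBox M)) := fun hv =>
    ((contDiff_comp_hypPoint hσ0 hσ hv.smooth).continuous.pow 2).continuousOn.integrableOn_compact
      isCompact_Icc
  have i0 := hi hu
  have i1 := hi h1
  have i2 := hi h2
  have i3 := hi h12
  unfold boostSq
  have j0 := i0.fun_add i0
  have j1 := j0.fun_add i1
  have j2 := j1.fun_add i2
  have j3 := j2.fun_add i2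
  refine ⟨j3.fun_add i3, ?_⟩
  rw [integral_add j3 i3, integral_add j2 i2, integral_add j1 i2, integral_add j0 i1,
    integral_add i0 i0]
  linarith [b₀ σ M hσ hM, b₁ σ M hσ hM, b₂ σ M hσ hM, b₃ σ M hσ hM]

theorem IsKGSol.exists_mem_period (hu : IsKGSol R u) {q : Coord} (hq : q ∈ half) :
    ∃ y ∈ Icc 0 (2 * Real.pi), u q = u (Function.update q 3 y) := by
  have hp : Function.Periodic (fun y => u (Function.update q 3 y)) (2 * Real.pi) := fun y => by
    have e : Function.update q 3 (y + 2 * Real.pi)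
        = Function.update q 3 y + Pi.single 3 (2 * Real.pi) := by
      funext i
      by_cases hi : i = 3
      · subst hi; simp
      · simp [hi]
    simp only [e]
    exact hu.periodic _ (by
      change 0 ≤ Function.update q 3 y 0
      rw [Function.update_of_ne (by decide)]; exact hq)
  obtain ⟨y, hy, h⟩ := hp.exists_mem_Ico₀ Real.two_pi_pos (q 3)
  rw [Function.update_eq_self] at h
  exact ⟨y, Ico_subset_Icc_self hy, h⟩

theorem IsKGSol.exists_late_decay (hu : IsKGSol R u) (hR : 0 ≤ R) :
    ∃ C : ℝ, 0 ≤ C ∧ ∀ q ∈ half, R ^ 2 + 1 ≤ q 0 → |u q| ≤ C * (1 + q 0)⁻¹ := by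
  obtain ⟨K₀, p₀, b₀⟩ := exists_boostSq_bound hu hR
  obtain ⟨K₁, p₁, b₁⟩ := exists_boostSq_bound (hu.D 3) hR
  refine ⟨Real.sqrt (K₀ + K₀ + K₁), Real.sqrt_nonneg _, fun q hq hq0 => ?_⟩
  have ht : 0 ≤ q 0 := hq
  by_cases hs : (R + q 0) ^ 2 < q 1 ^ 2 + q 2 ^ 2
  · rw [hu.support q hq hs, abs_zero]; positivity
  rw [not_lt] at hs
  obtain ⟨y, hy, huy⟩ := hu.exists_mem_period hq
  -- This is the hyperboloid through `q`. On the support σ ≥ (t + R + 1)² - (t + R)² = 2t + 2R + 1,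
  -- which exceeds (R + 1)² because t ≥ R² + 1. The weight σ + |x|² in the Sobolev estimate is
  -- exactly (t + R + 1)².
  set σ := (q 0 + (R + 1)) ^ 2 - q 1 ^ 2 - q 2 ^ 2 with hσdef
  have hσ1 : 2 * q 0 + 2 * R + 1 ≤ σ := by nlinarith
  have hσ : (R + 1) ^ 2 < σ := by nlinarith
  have hsum : σ + q 1 ^ 2 + q 2 ^ 2 = (q 0 + (R + 1)) ^ 2 := by rw [hσdef]; ring
  have hpt : hypPoint σ (R + 1) ![q 1, q 2, y] = Function.update q 3 y := by
    funext i
    refine Fin.cases ?_ (fun j => ?_) i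
    · rw [hypPoint_zero, Function.update_of_ne (by decide)]
      change Real.sqrt (σ + q 1 ^ 2 + q 2 ^ 2) - (R + 1) = q 0
      rw [hsum, Real.sqrt_sq (by linarith)]
      ring
    · rw [hypPoint_succ]
      fin_cases j
      · rfl
      · rfl
      · simp
  have ha1 : |q 1| ≤ σ + 1 := abs_le_of_sq_le_sq (by nlinarith [sq_nonneg (q 2)]) (by linarith)
  have ha2 : |q 2| ≤ σ + 1 := abs_le_of_sq_le_sq (by nlinarith [sq_nonneg (q 1)]) (by linarith)
  have main := sq_le_integral_boostSq hu hR hσ le_rfl ha1 ha2 hy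
  obtain ⟨i0, B0⟩ := b₀ σ _ hσ le_rfl
  obtain ⟨i1, B1⟩ := b₁ σ _ hσ le_rfl
  rw [integral_add (Integrable.fun_add i0 i0) i1, integral_add i0 i0, hpt, ← huy, hsum] at main
  have hK : u q ^ 2 ≤ ((q 0 + (R + 1)) ^ 2)⁻¹ * (K₀ + K₀ + K₁) :=
    main.trans (mul_le_mul_of_nonneg_left (by linarith) (by positivity))
  refine (Real.abs_le_sqrt hK).trans ?_
  rw [mul_comm, Real.sqrt_mul (by positivity), Real.sqrt_inv, Real.sqrt_sq (by linarith)]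
  exact mul_le_mul_of_nonneg_left (inv_anti₀ (by linarith) (by linarith)) (Real.sqrt_nonneg _)

/-- Up to periods in y, the support within a bounded time slab lies in a compact box. -/
theorem IsKGSol.exists_early_bound (hu : IsKGSol R u) (hR : 0 ≤ R) (t₀ : ℝ) :
    ∃ C : ℝ, 0 ≤ C ∧ ∀ q ∈ half, q 0 ≤ t₀ → |u q| ≤ C := by
  let B : Set Coord := Icc ![0, -(R + t₀), -(R + t₀), 0] ![t₀, R + t₀, R + t₀, 2 * Real.pi]
  have hsub : B ⊆ half := fun q hq => hq.1 0
  obtain ⟨C, hC⟩ := (isCompact_Icc : IsCompact B).exists_bound_of_continuousOn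
    (hu.smooth.continuousOn.mono hsub)
  refine ⟨max C 0, le_max_right _ _, fun q hq hq0 => ?_⟩
  have ht : 0 ≤ q 0 := hq
  by_cases hs : (R + q 0) ^ 2 < q 1 ^ 2 + q 2 ^ 2
  · rw [hu.support q hq hs, abs_zero]; exact le_max_right _ _
  rw [not_lt] at hs
  obtain ⟨y, hy, huy⟩ := hu.exists_mem_period hq
  have h1 : |q 1| ≤ R + q 0 := abs_le_of_sq_le_sq (by nlinarith [sq_nonneg (q 2)]) (by linarith)
  have h2 : |q 2| ≤ R + q 0 := abs_le_of_sq_le_sq (by nlinarith [sq_nonneg (q 1)]) (by linarith)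
  obtain ⟨h1, h1'⟩ := abs_le.1 h1
  obtain ⟨h2, h2'⟩ := abs_le.1 h2
  rw [huy, ← Real.norm_eq_abs]
  refine (hC _ ?_).trans (le_max_left _ _)
  rw [mem_Icc, Pi.le_def, Pi.le_def]
  simp only [Fin.forall_fin_succ]
  have n0 : (0 : Fin 4) ≠ 3 := by decide
  have n1 : (1 : Fin 4) ≠ 3 := by decide
  have n2 : (2 : Fin 4) ≠ 3 := by decide
  have e0 := Function.update_of_ne n0 y q
  have e1 := Function.update_of_ne n1 y q
  have e2 := Function.update_of_ne n2 y q
  have e3 := Function.update_self (3 : Fin 4) y q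
  refine ⟨⟨?_, ?_, ?_, ?_, fun i => i.elim0⟩, ?_, ?_, ?_, ?_, fun i => i.elim0⟩
  · exact e0.symm ▸ ht
  · exact (by linarith : -(R + t₀) ≤ q 1).trans_eq e1.symm
  · exact (by linarith : -(R + t₀) ≤ q 2).trans_eq e2.symm
  · exact hy.1.trans_eq e3.symm
  · exact e0.trans_le hq0
  · exact e1.trans_le (by change q 1 ≤ R + t₀; linarith)
  · exact e2.trans_le (by change q 2 ≤ R + t₀; linarith)
  · exact e3.trans_le hy.2

/-- Solutions with compactly supported data decay like `1 / t`. -/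
theorem IsKGSol.exists_decay (hu : IsKGSol R u) (hR : 0 ≤ R) :
    ∃ C : ℝ, 0 ≤ C ∧ ∀ q ∈ half, |u q| ≤ C * (1 + q 0)⁻¹ := by
  obtain ⟨C₁, p₁, b₁⟩ := hu.exists_late_decay hR
  obtain ⟨C₂, p₂, b₂⟩ := hu.exists_early_bound hR (R ^ 2 + 1)
  -- The factor R² + 2 is 1 + t at the threshold t = R² + 1, so it absorbs the missing decay at
  -- earlier times.
  refine ⟨C₁ + C₂ * (R ^ 2 + 2), by positivity, fun q hq => ?_⟩
  have ht : 0 ≤ q 0 := hq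
  have hp : 0 < 1 + q 0 := by linarith
  rw [add_mul]
  rcases le_total (R ^ 2 + 1) (q 0) with h | h
  · have := b₁ q hq h
    have : 0 ≤ C₂ * (R ^ 2 + 2) * (1 + q 0)⁻¹ := by positivity
    linarith
  · have h1 := b₂ q hq h
    have h2 : C₂ ≤ C₂ * (R ^ 2 + 2) * (1 + q 0)⁻¹ := by
      rw [← div_eq_mul_inv, le_div_iff₀ hp]
      exact mul_le_mul_of_nonneg_left (by linarith) p₂
    have : 0 ≤ C₁ * (1 + q 0)⁻¹ := by positivity
    linarith

theorem IsKGSol.exists_decay_complex {v : Coord → ℂ} (hv : IsKGSol R v) (hR : 0 ≤ R) :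
    ∃ C : ℝ, 0 ≤ C ∧ ∀ q ∈ half, ‖v q‖ ≤ C * (1 + q 0)⁻¹ := by
  obtain ⟨C₁, p₁, b₁⟩ := (hv.clm Complex.reCLM).exists_decay hR
  obtain ⟨C₂, p₂, b₂⟩ := (hv.clm Complex.imCLM).exists_decay hR
  refine ⟨C₁ + C₂, by positivity, fun q hq => (Complex.norm_le_abs_re_add_abs_im _).trans ?_⟩
  rw [add_mul]
  exact add_le_add (b₁ q hq) (b₂ q hq)

end

/-! ### Transfer between ℝ² × 𝕋 and coordinates on the cover -/

/-- The point of `ℝ² × 𝕋` with coordinates `(q 1, q 2, q 3)`. -/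
def toSpace (q : Coord) : Space := (!₂[q 1, q 2], (q 3 : Torus))

/-- A function on `[0, ∞) × ℝ² × 𝕋` in the coordinates `(t, x₁, x₂, y)`. -/
def lift (V : ℝ → Space → ℂ) (q : Coord) : ℂ := V (q 0) (toSpace q)

theorem exists_toSpace_eq (t : ℝ) (p : Space) : ∃ q : Coord, q 0 = t ∧ toSpace q = p := by
  obtain ⟨x, y⟩ := p
  obtain ⟨s, rfl⟩ := QuotientAddGroup.mk_surjective y
  refine ⟨![t, x 0, x 1, s], rfl, ?_⟩
  refine Prod.ext ?_ rfl
  ext i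
  fin_cases i <;> rfl

theorem toSpace_add_single_succ (q : Coord) (j : Fin 3) (s : ℝ) :
    toSpace (q + Pi.single j.succ s) = toSpace q + shift j s := by
  refine Prod.ext ?_ ?_
  · ext i
    fin_cases j <;> fin_cases i <;> simp [toSpace, shift]
  · fin_cases j <;> simp [toSpace, shift]

theorem lift_periodic (V : ℝ → Space → ℂ) (q : Coord) :
    lift V (q + Pi.single 3 (2 * Real.pi)) = lift V q := by
  have : toSpace (q + Pi.single 3 (2 * Real.pi)) = toSpace q := by
    refine Prod.ext ?_ ?_
    · simp [toSpace]
    · simp [toSpace]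
  simp [lift, this]

theorem contDiffOn_lift {V : ℝ → Space → ℂ} (hV : IsSmoothOnHalfLine V) :
    ContDiffOn ℝ ∞ (lift V) half := by
  have h : ContDiff ℝ ∞ (fun q : Coord => (q 0, (!₂[q 1, q 2], q 3)) : Coord → ℝ × (Plane × ℝ)) := by
    refine (contDiff_apply ℝ ℝ 0).prodMk (ContDiff.prodMk ?_ (contDiff_apply ℝ ℝ 3))
    rw [contDiff_euclidean]
    intro i
    fin_cases i
    · exact contDiff_apply ℝ ℝ 1
    · exact contDiff_apply ℝ ℝ 2
  exact hV.comp h.contDiffOn fun q hq => ⟨hq, mem_univ _⟩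

section derivatives

variable {W : ℝ → Space → ℂ} {q : Coord}

theorem D_succ_lift (hW : ContDiffOn ℝ ∞ (lift W) half) (hq : q ∈ half) (j : Fin 3) :
    D j.succ (lift W) q = lift (fun t => pderiv j (W t)) q := by
  have h := hasDerivAt_update_of_ne hW hq (Fin.succ_ne_zero j) (q j.succ)
  rw [Function.update_eq_self] at h
  have h2 : HasDerivAt (fun s : ℝ => lift W (q + Pi.single j.succ s)) (D j.succ (lift W) q) 0 := by
    have h4 := HasDerivAt.comp_const_add (q j.succ) 0 (by simpa using h)
    refine h4.congr_of_eventuallyEq (.of_forall fun s => ?_)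
    change _ = lift W (Function.update q j.succ (q j.succ + s))
    refine congrArg (lift W) ?_
    funext i
    by_cases hi : i = j.succ
    · subst hi; simp
    · simp [hi]
  rw [← h2.deriv]
  simp only [lift, pderiv, toSpace_add_single_succ]
  congr 1
  funext s
  simp [(Fin.succ_ne_zero j).symm]

theorem D_zero_lift (hW : ContDiffOn ℝ ∞ (lift W) half) (hq : q ∈ half) :
    D 0 (lift W) q = lift (dt W) q := by
  have hq' : 0 ≤ q 0 := hq
  have hmaps : MapsTo (Function.update q 0) (Ici 0) half := fun s hs => by
    change 0 ≤ Function.update q 0 s 0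
    rw [Function.update_self]; exact hs
  have h1 : HasFDerivWithinAt (lift W) (fderivWithin ℝ (lift W) half q) half
      (Function.update q 0 (q 0)) := by
    rw [Function.update_eq_self]; exact (hW.diffWithinAt_half hq).hasFDerivWithinAt
  have h := h1.comp_hasDerivWithinAt (q 0) ((hasDerivAt_update q 0 (q 0)).hasDerivWithinAt
    (s := Ici 0)) hmaps
  have e : lift W ∘ Function.update q 0 = fun τ => W τ (toSpace q) := by
    funext s
    simp [lift, toSpace]
  rw [e] at h
  rw [lift, dt, h.derivWithin (uniqueDiffOn_Ici 0 (q 0) hq')]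
  rfl

theorem D_D_succ_lift (hW : ContDiffOn ℝ ∞ (lift W) half) (hq : q ∈ half) (j : Fin 3) :
    D j.succ (D j.succ (lift W)) q = lift (fun t => pderiv j (pderiv j (W t))) q := by
  have h : EqOn (D j.succ (lift W)) (lift fun t => pderiv j (W t)) half := fun p hp =>
    D_succ_lift hW hp j
  rw [D_congr h hq, D_succ_lift ((contDiffOn_D hW _).congr fun p hp => (h hp).symm) hq]

theorem D_D_zero_lift (hW : ContDiffOn ℝ ∞ (lift W) half) (hq : q ∈ half) :
    D 0 (D 0 (lift W)) q = lift (dt (dt W)) q := by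
  have h : EqOn (D 0 (lift W)) (lift (dt W)) half := fun p hp => D_zero_lift hW hp
  rw [D_congr h hq, D_zero_lift ((contDiffOn_D hW _).congr fun p hp => (h hp).symm) hq]

theorem kgOp_lift (hW : ContDiffOn ℝ ∞ (lift W) half) (hq : q ∈ half) : kgOp (lift W) q
    = dt (dt W) (q 0) (toSpace q) - laplacian (W (q 0)) (toSpace q) + W (q 0) (toSpace q) := by
  rw [kgOp, D_D_zero_lift hW hq, show (1 : Fin 4) = Fin.succ 0 from rfl,
    show (2 : Fin 4) = Fin.succ 1 from rfl, show (3 : Fin 4) = Fin.succ 2 from rfl,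
    D_D_succ_lift hW hq, D_D_succ_lift hW hq, D_D_succ_lift hW hq, laplacian, Fin.sum_univ_three]
  rfl

end derivatives

section closure

variable {R : ℝ} {W : ℝ → Space → ℂ}

theorem IsKGSol.pderiv_lift (hW : IsKGSol R (lift W)) (j : Fin 3) :
    IsKGSol R (lift fun t => pderiv j (W t)) :=
  (hW.D j.succ).congr fun _ hq => (D_succ_lift hW.smooth hq j).symm

theorem IsKGSol.dt_lift (hW : IsKGSol R (lift W)) : IsKGSol R (lift (dt W)) :=
  (hW.D 0).congr fun _ hq => (D_zero_lift hW.smooth hq).symm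

theorem IsKGSol.iterate_pderiv_lift (hW : IsKGSol R (lift W)) (j : Fin 3) (n : ℕ) :
    IsKGSol R (lift fun t => (pderiv j)^[n] (W t)) := by
  induction n with
  | zero => exact hW
  | succ n ih => simpa only [Function.iterate_succ_apply'] using ih.pderiv_lift j

theorem IsKGSol.multiDeriv_lift (hW : IsKGSol R (lift W)) (ρ : Fin 3 → ℕ) :
    IsKGSol R (lift fun t => multiDeriv ρ (W t)) :=
  ((hW.iterate_pderiv_lift 2 _).iterate_pderiv_lift 1 _).iterate_pderiv_lift 0 _

theorem IsKGSol.exists_supNorm_le (hW : IsKGSol R (lift W)) (hR : 0 ≤ R) :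
    ∃ C : ℝ, 0 ≤ C ∧ ∀ t, 0 ≤ t → supNorm (W t) ≤ ENNReal.ofReal (C * (1 + t)⁻¹) := by
  obtain ⟨C, hC, h⟩ := hW.exists_decay_complex hR
  refine ⟨C, hC, fun t ht => ?_⟩
  rw [supNorm, eLpNorm_exponent_top]
  refine eLpNormEssSup_le_of_ae_bound (.of_forall fun p => ?_)
  obtain ⟨q, rfl, rfl⟩ := exists_toSpace_eq t p
  exact h q ht

theorem exists_sum_supNorm_le {ι : Type*} (s : Finset ι) {W : ι → ℝ → Space → ℂ}
    (hW : ∀ i ∈ s, IsKGSol R (lift (W i))) (hR : 0 ≤ R) :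
    ∃ C : ℝ, 0 ≤ C ∧ ∀ t, 0 ≤ t →
      ∑ i ∈ s, supNorm (W i t) ≤ ENNReal.ofReal (C * (1 + t)⁻¹) := by
  have h : ∀ i, ∃ C : ℝ, 0 ≤ C ∧ (i ∈ s → ∀ t, 0 ≤ t →
      supNorm (W i t) ≤ ENNReal.ofReal (C * (1 + t)⁻¹)) := fun i => by
    by_cases hi : i ∈ s
    · obtain ⟨C, hC, h⟩ := (hW i hi).exists_supNorm_le hR
      exact ⟨C, hC, fun _ => h⟩
    -- The value 0 off `s` makes the choice of constants total on the index type.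
    · exact ⟨0, le_rfl, fun h => absurd h hi⟩
  choose C hC h using h
  refine ⟨∑ i ∈ s, C i, Finset.sum_nonneg fun i _ => hC i, fun t ht => ?_⟩
  rw [Finset.sum_mul, ENNReal.ofReal_sum_of_nonneg fun i _ => mul_nonneg (hC i) (by positivity)]
  exact Finset.sum_le_sum fun i hi => h i hi t ht

end closure

/-! ### Uniqueness, support and decay of smooth solutions -/

/-- Finite speed of propagation for complex-valued solutions. -/
theorem eq_zero_of_initial_eq_zero_complex {v : Coord → ℂ} (hv : ContDiffOn ℝ ∞ v half)
    (heq : ∀ q ∈ half, kgOp v q = 0)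
    (hper : ∀ q ∈ half, v (q + Pi.single 3 (2 * Real.pi)) = v q) {q₀ : Coord} (hq₀ : q₀ ∈ half)
    {r : ℝ} (hr : q₀ 0 < r)
    (hdata : ∀ q : Coord, q 0 = 0 → (q 1 - q₀ 1) ^ 2 + (q 2 - q₀ 2) ^ 2 < r ^ 2 →
      v q = 0 ∧ D 0 v q = 0) : v q₀ = 0 := by
  -- The energy density contains all first derivatives. The spatial ones vanish since v vanishes on
  -- a relatively open part of the slice t = 0.
  have hx : ∀ q : Coord, q 0 = 0 → (q 1 - q₀ 1) ^ 2 + (q 2 - q₀ 2) ^ 2 < r ^ 2 →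
      ∀ j, D j v q = 0 := by
    intro q hq h j
    by_cases hj : j = 0
    · subst hj; exact (hdata q hq h).2
    have hd := hasDerivAt_update_of_ne hv (q := q) (show (0 : ℝ) ≤ q 0 from hq.ge) hj (q j)
    rw [Function.update_eq_self] at hd
    refine hd.unique ((hasDerivAt_const (q j) (0 : ℂ)).congr_of_eventuallyEq ?_)
    have ho : IsOpen {p : Coord | (p 1 - q₀ 1) ^ 2 + (p 2 - q₀ 2) ^ 2 < r ^ 2} :=
      isOpen_lt (by fun_prop) continuous_const
    have hc : ContinuousAt (fun s : ℝ => Function.update q j s) (q j) :=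
      (hasDerivAt_update q j (q j)).continuousAt
    filter_upwards [hc.preimage_mem_nhds (ho.mem_nhds (by
      rw [Function.update_eq_self]; exact h))] with s hs
    exact (hdata _ (by rw [Function.update_of_ne (Ne.symm hj), hq]) hs).1
  have real : ∀ ℓ : ℂ →L[ℝ] ℝ, ℓ (v q₀) = 0 := fun ℓ => by
    have hs : ContDiffOn ℝ ∞ (fun q => ℓ (v q)) half := ℓ.contDiff.comp_contDiffOn hv
    refine eq_zero_of_initial_eq_zero hs (fun q hq => ?_) (fun q hq => by rw [hper q hq])
      hq₀ hr fun q hq h => ?_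
    · rw [← map_zero ℓ, ← heq q hq, kgOp, kgOp]
      simp only [D_D_clm ℓ hv hq, map_add, map_sub]
    · have hq' : q ∈ half := show (0 : ℝ) ≤ q 0 from hq.ge
      simp [current, D_clm ℓ (hv.diffWithinAt_half hq') hq', hx q hq h, (hdata q hq h).1]
  exact Complex.ext (real Complex.reCLM) (real Complex.imCLM)

section solutions

variable {V V' : ℝ → Space → ℂ} {V₀ V₁ : Space → ℂ}

theorem IsSmoothSolution.kgOp_lift_eq_zero (hV : IsSmoothSolution V V₀ V₁) {q : Coord}
    (hq : q ∈ half) : kgOp (lift V) q = 0 := by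
  rw [kgOp_lift (contDiffOn_lift hV.smooth) hq, hV.equation _ hq]

theorem IsSmoothSolution.lift_zero (hV : IsSmoothSolution V V₀ V₁) {q : Coord} (hq : q 0 = 0) :
    lift V q = V₀ (toSpace q) := by
  rw [lift, hq, hV.initial_value]

theorem IsSmoothSolution.D_zero_lift_zero (hV : IsSmoothSolution V V₀ V₁) {q : Coord}
    (hq : q 0 = 0) : D 0 (lift V) q = V₁ (toSpace q) := by
  rw [D_zero_lift (contDiffOn_lift hV.smooth) (show (0 : ℝ) ≤ q 0 from hq.ge), lift, hq,
    hV.initial_velocity]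

/-- Smooth solutions are determined by their data. -/
theorem IsSmoothSolution.unique (hV : IsSmoothSolution V V₀ V₁) (hV' : IsSmoothSolution V' V₀ V₁)
    {t : ℝ} (ht : 0 ≤ t) : V t = V' t := by
  funext p
  obtain ⟨q, rfl, rfl⟩ := exists_toSpace_eq t p
  have s := contDiffOn_lift hV.smooth
  have s' := contDiffOn_lift hV'.smooth
  refine sub_eq_zero.1 (eq_zero_of_initial_eq_zero_complex (v := fun q => lift V q - lift V' q)
    (s.sub s') (fun p hp => ?_) (fun p _ => by simp only [lift_periodic]) ht (lt_add_one (q 0))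
    fun p hp _ => ⟨?_, ?_⟩)
  · have h := hV.kgOp_lift_eq_zero hp
    have h' := hV'.kgOp_lift_eq_zero hp
    rw [kgOp] at h h' ⊢
    simp only [D_D_sub s s' hp]
    linear_combination h - h'
  · simp only [hV.lift_zero hp, hV'.lift_zero hp, sub_self]
  · have hp' : p ∈ half := show (0 : ℝ) ≤ p 0 from hp.ge
    rw [D_sub (s.diffWithinAt_half hp') (s'.diffWithinAt_half hp') hp', hV.D_zero_lift_zero hp,
      hV'.D_zero_lift_zero hp, sub_self]

theorem exists_radius {f : Space → ℂ} (hf : HasCompactSupport f) :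
    ∃ R : ℝ, 0 ≤ R ∧ ∀ p : Space, R < ‖p.1‖ → f p = 0 := by
  obtain ⟨R, hR⟩ := (hf.isCompact.image continuous_fst).isBounded.exists_norm_le
  refine ⟨max R 0, le_max_right _ _, fun p hp => ?_⟩
  by_contra hne
  exact absurd (hR p.1 ⟨p, subset_tsupport f hne, rfl⟩) (not_le.2 ((le_max_left _ _).trans_lt hp))

theorem norm_toSpace_fst (q : Coord) : ‖(toSpace q).1‖ = Real.sqrt (q 1 ^ 2 + q 2 ^ 2) := by
  rw [EuclideanSpace.norm_eq, Fin.sum_univ_two]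
  simp [toSpace]

/-- A smooth solution whose data vanish for `|x| > R` vanishes for `|x| > R + t`. -/
theorem IsSmoothSolution.isKGSol (hV : IsSmoothSolution V V₀ V₁) {R : ℝ}
    (h₀ : ∀ p : Space, R < ‖p.1‖ → V₀ p = 0) (h₁ : ∀ p : Space, R < ‖p.1‖ → V₁ p = 0) :
    IsKGSol R (lift V) where
  smooth := contDiffOn_lift hV.smooth
  equation q hq := hV.kgOp_lift_eq_zero hq
  periodic q _ := lift_periodic V q
  support q hq hs := by
    have hq' : 0 ≤ q 0 := hq
    have hlt : R + q 0 < ‖(toSpace q).1‖ := by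
      rw [norm_toSpace_fst]; exact Real.lt_sqrt_of_sq_lt hs
    -- The base of the backward cone has radius |x| - R, which exceeds t, and by the triangle
    -- inequality it avoids |x| ≤ R, where the data may be nonzero.
    refine eq_zero_of_initial_eq_zero_complex (contDiffOn_lift hV.smooth)
      (fun p hp => hV.kgOp_lift_eq_zero hp) (fun p _ => lift_periodic V p) hq
      (r := ‖(toSpace q).1‖ - R) (by linarith) fun p hp hps => ?_
    have hd : ‖(toSpace p).1 - (toSpace q).1‖ < ‖(toSpace q).1‖ - R := by
      have e : ‖(toSpace p).1 - (toSpace q).1‖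
          = Real.sqrt ((p 1 - q 1) ^ 2 + (p 2 - q 2) ^ 2) := by
        rw [EuclideanSpace.norm_eq, Fin.sum_univ_two]
        simp [toSpace]
      rw [e]
      exact (Real.sqrt_lt' (by linarith)).2 hps
    have hp' : R < ‖(toSpace p).1‖ := by
      have := norm_sub_norm_le (toSpace q).1 (toSpace p).1
      rw [norm_sub_rev] at this
      linarith
    exact ⟨by rw [hV.lift_zero hp, h₀ _ hp'], by rw [hV.D_zero_lift_zero hp, h₁ _ hp']⟩

/-- The decay estimate for a single solution. -/
theorem IsSmoothSolution.exists_decay (hV : IsSmoothSolution V V₀ V₁)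
    (h₀ : HasCompactSupport V₀) (h₁ : HasCompactSupport V₁) :
    ∃ C : ℝ, 0 < C ∧ ∀ t : ℝ, 0 ≤ t →
      ∑ ρ ∈ multiIndices 2, supNorm (multiDeriv ρ (V t))
        + ∑ ρ ∈ multiIndices 1, supNorm (multiDeriv ρ (dt V t))
      ≤ ENNReal.ofReal (C * (1 + t)⁻¹) := by
  obtain ⟨R₀, p₀, b₀⟩ := exists_radius h₀
  obtain ⟨R₁, p₁, b₁⟩ := exists_radius h₁
  have hR : 0 ≤ R₀ + R₁ := add_nonneg p₀ p₁
  have hK := hV.isKGSol (R := R₀ + R₁) (fun p hp => b₀ p (by linarith))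
    (fun p hp => b₁ p (by linarith))
  obtain ⟨C, hC, h⟩ := exists_sum_supNorm_le (multiIndices 2)
    (fun ρ _ => hK.multiDeriv_lift ρ) hR
  obtain ⟨C', hC', h'⟩ := exists_sum_supNorm_le (multiIndices 1)
    (fun ρ _ => hK.dt_lift.multiDeriv_lift ρ) hR
  -- The summand 1 only makes the constant strictly positive.
  refine ⟨C + C' + 1, by positivity, fun t ht => ?_⟩
  have ht' : 0 ≤ (1 + t)⁻¹ := by positivity
  refine (add_le_add (h t ht) (h' t ht)).trans ?_
  rw [← ENNReal.ofReal_add (by positivity) (by positivity)]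
  refine ENNReal.ofReal_le_ofReal ?_
  nlinarith

end solutions

end KG

end

theorem theoremB1 (V₀ V₁ : KG.Space → ℂ)
    (hV₀ : KG.IsTestFunction V₀) (hV₁ : KG.IsTestFunction V₁) :
    ∃ C : ℝ, 0 < C ∧
      ∀ V : ℝ → KG.Space → ℂ, KG.IsSmoothSolution V V₀ V₁ →
        ∀ t : ℝ, 0 ≤ t →
          ∑ ρ ∈ KG.multiIndices 2, KG.supNorm (KG.multiDeriv ρ (V t))
            + ∑ ρ ∈ KG.multiIndices 1, KG.supNorm (KG.multiDeriv ρ (KG.dt V t))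
          ≤ ENNReal.ofReal (C * (1 + t)⁻¹) := by
  -- The data determine the solution, so that a constant for one solution serves for all of them.
  by_cases h : ∃ U, KG.IsSmoothSolution U V₀ V₁
  · obtain ⟨U, hU⟩ := h
    obtain ⟨C, hC, hdecay⟩ := hU.exists_decay hV₀.2 hV₁.2
    refine ⟨C, hC, fun V hV t ht => ?_⟩
    have hdt : KG.dt V t = KG.dt U t := funext fun p =>
      derivWithin_congr (fun τ hτ => congrFun (hV.unique hU hτ) p) (congrFun (hV.unique hU ht) p)
    rw [hV.unique hU ht, hdt]
    exact hdecay t ht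
  · exact ⟨1, one_pos, fun V hV => absurd ⟨V, hV⟩ h⟩
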